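/- Let $n\ge 3$ be odd, let $m=\operatorname{ord}_n(2)$ be the multiplicative order of $2$ modulo $n$, and suppose that $2^{\lfloor m/2\rfloor}<n\le 2^m-1$. Put $\kappa=\frac{n}{2^m-1}\left(2^{\lceil m/2\rceil}-1\right)$ and $$r=\min\left\{\left\lfloor \frac{n\,2^{\lceil m/2\rceil}}{2^m-1}-1\right\rfloor,\ n-1,\ \lfloor\kappa\rfloor\right\}.$$ Let $a,b$ be odd integers with $1\le a<b<r$, and put $t=(b-1)/2$ and $u=(a-1)/2$. Let $\alpha$ be a primitive $n$-th root of unity in an extension field of $\mathbb F_2$, and let $M_i(x)$ be the minimal polynomial of $\alpha^i$ over $\mathbb F_2$. Let $C$ and $D$ be the binary narrow-sense BCH codes of length $n$ with design distances $b+1$ and $a+1$, that is, the cyclic codes generated by $\operatorname{lcm}\{M_1(x),\dots,M_b(x)\}$ and $\operatorname{lcm}\{M_1(x),\dots,M_a(x)\}$. Let $d$ and $d^*$ be the minimum distances of $C$ and $D$. Then $C\subseteq D$, $d\ge b+1$, $d^*\ge a+1$, $2m(t+1)\le n$, and for all non-negative integers $a_l,a_r$ with $a_l+a_r<m(t-u)$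 there exists an $(a_l,a_r)$-$[[n+a_l+a_r,\ n-2m(t+1)]]$ quantum synchronizable code that corrects up to at least $\lfloor\frac{d-1}{2}\rfloor$ phase errors and up to at least $\lfloor\frac{d^*-1}{2}\rfloor$ bit errors. Here an $(a_l,a_r)$-$[[N,k]]$ quantum synchronizable code correcting $e_p$ phase errors and $e_b$ bit errors is an isometric encoding $V$ of $k$ qubits into $N$ qubits such that (i) a single quantum channel recovers every encoded state after every Pauli error $X^eZ^f$ with $\operatorname{wt}(e)\le e_b$ and $\operatorname{wt}(f)\le e_p$; and (ii) there is a projective measurement of $N$ qubits with the following property: if $N$ consecutive qubits are read from a stream of consecutive blocks, each encoded with $V$ and each with at most $e_b$ bit errors and at most $e_p$ phase errors, and the reading frame is misaligned with a block by $\delta$ qubits, $-a_l\le\delta\le a_r$ (to the left if $\delta<0$, to the right if $\delta>0$), then the measurement of these qubits yields $\delta$ with certainty and does not disturb the state of the stream. -/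

import Mathlib

/-! ### Binary cyclic codes and BCH codes -/

/-- The polynomial `c₀ + c₁ X + ⋯ + c_{n-1} X^{n-1}` of a binary word of length `n`. -/
noncomputable def wordPoly {n : ℕ} (c : Fin n → ZMod 2) : Polynomial (ZMod 2) :=
  ∑ i : Fin n, Polynomial.monomial (i : ℕ) (c i)

/-- The binary cyclic code of length `n` with generator polynomial `g`, where `g ∣ X ^ n - 1`:
the words whose polynomial is a multiple of `g`. -/
noncomputable def cyclicCode (n : ℕ) (g : Polynomial (ZMod 2)) :
    Submodule (ZMod 2) (Fin n → ZMod 2) where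
  carrier := {c | g ∣ wordPoly c}
  zero_mem' := by simp [wordPoly]
  add_mem' := by
    intro c d hc hd
    have h : wordPoly (c + d) = wordPoly c + wordPoly d := by
      simp [wordPoly, Finset.sum_add_distrib]
    change g ∣ wordPoly (c + d)
    rw [h]
    exact dvd_add hc hd
  smul_mem' := by
    intro r c hc
    have h : wordPoly (r • c) = r • wordPoly c := by
      simp [wordPoly, Finset.smul_sum, Polynomial.smul_monomial]
    change g ∣ wordPoly (r • c)
    rw [h, Polynomial.smul_eq_C_mul]
    exact Dvd.dvd.mul_left hc _

/-- The generator polynomial `lcm (M_{s}, M_{s+1}, …, M_{s+δ-2})` of the binary BCH code with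
design distance `δ`, where `M_i` is the minimal polynomial of `α ^ i` over `𝔽₂`.  The `M_i` are
monic and irreducible, so their lcm is the product of the distinct ones among them. -/
noncomputable def bchGenerator {F : Type*} [Field F] [Algebra (ZMod 2) F] (α : F) (s δ : ℕ) :
    Polynomial (ZMod 2) :=
  open Classical in
  ∏ p ∈ (Finset.Ico s (s + δ - 1)).image (fun i : ℕ => minpoly (ZMod 2) (α ^ i)), p

/-- The binary narrow-sense (`s = 1`) BCH code of length `n` and design distance `δ` with respect
to the primitive `n`-th root of unity `α`. -/
noncomputable def narrowSenseBCH {F : Type*} [Field F] [Algebra (ZMod 2) F] (α : F) (n δ : ℕ) :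
    Submodule (ZMod 2) (Fin n → ZMod 2) :=
  cyclicCode n (bchGenerator α 1 δ)

/-- The minimum distance of a binary code: the least Hamming distance of two distinct codewords. -/
noncomputable def minDistance {n : ℕ} (C : Submodule (ZMod 2) (Fin n → ZMod 2)) : ℕ :=
  sInf {w | ∃ c ∈ C, ∃ c' ∈ C, c ≠ c' ∧ hammingDist c c' = w}

/-! ### Systems of qubits

The state space of qubits labelled by a finite type `S` is `ℂ^(S → ZMod 2)`; the standard basis
vectors `|x⟩` are labelled by the bit strings `x : S → ZMod 2`. -/

/-- Operators from the qubits labelled by `S` to the qubits labelled by `T`. -/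
abbrev QubitOp (T S : Type*) := Matrix (T → ZMod 2) (S → ZMod 2) ℂ

/-- The Pauli operator `X^e Z^f`, that is `|x⟩ ↦ (-1)^(f · x) |x + e⟩`: a bit error on each qubit of
the support of `e`, a phase error on each qubit of the support of `f`, and both (`XZ = -iY`) where
the supports meet. -/
def pauli {S : Type*} [Fintype S] [DecidableEq S] (e f : S → ZMod 2) : QubitOp S S :=
  fun y x => if y = x + e then (-1 : ℂ) ^ (∑ s, f s * x s).val else 0

/-- The operator `P`, applied to the qubits `w 0, …, w (N-1)` of the system `S` (for `w` injective)
and tensored with the identity on all other qubits. -/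
noncomputable def onQubits {S : Type*} {N : ℕ} (w : Fin N → S) (P : QubitOp (Fin N) (Fin N)) :
    QubitOp S S :=
  open Classical in
  fun y x => if ∀ s, s ∉ Set.range w → y s = x s then P (y ∘ w) (x ∘ w) else 0

/-- The encoder of a stream of `B` consecutive blocks, `V ⊗ V ⊗ ⋯ ⊗ V`.  The qubit `(i, j)` is
qubit `j` of block `i`. -/
def streamEncoder {N k : ℕ} (B : ℕ) (V : QubitOp (Fin N) (Fin k)) :
    QubitOp (Fin B × Fin N) (Fin B × Fin k) :=
  fun x y => ∏ i : Fin B, V (fun j => x (i, j)) (fun j => y (i, j))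

/-- `w` lists the `N` consecutive qubits of the stream that one reads when block `i` is read with
misalignment `δ`: by `δ` qubits to the right if `δ ≥ 0`, by `-δ` qubits to the left if `δ ≤ 0`.
The qubit `(i, j)` is at place `i * N + j` of the stream. -/
def IsWindow {B N : ℕ} (i : Fin B) (δ : ℤ) (w : Fin N → Fin B × Fin N) : Prop :=
  ∀ j : Fin N, (((w j).1 : ℕ) : ℤ) * (N : ℤ) + (((w j).2 : ℕ) : ℤ)
    = ((i : ℕ) : ℤ) * (N : ℤ) + ((j : ℕ) : ℤ) + δ

/-! ### Quantum synchronizable codes -/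

/-- `V` is the encoder of an `(al, ar)-[[N, k]]` quantum synchronizable code that corrects up to `tp`
phase errors and up to `tb` bit errors in each block. -/
structure IsQSC {N k : ℕ} (V : QubitOp (Fin N) (Fin k)) (al ar tp tb : ℕ) : Prop where
  /-- The encoder is an isometry from `k` qubits to `N` qubits. -/
  isometry : V.conjTranspose * V = 1
  /-- Correction of bit and phase errors: one quantum channel, with Kraus operators `R 0, R 1, …`,
  recovers the encoded state after every Pauli error with at most `tb` bit errors and at most `tp`
  phase errors. -/
  recovery : ∃ (J : ℕ) (R : Fin J → QubitOp (Fin k) (Fin N)),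
    ∑ j, (R j).conjTranspose * R j = 1 ∧
    ∀ e f : Fin N → ZMod 2, hammingNorm e ≤ tb → hammingNorm f ≤ tp →
      ∀ ρ : QubitOp (Fin k) (Fin k),
        ∑ j, R j * (pauli e f * V * ρ * (pauli e f * V).conjTranspose) * (R j).conjTranspose = ρ
  /-- Correction of misalignment: there is a projective measurement `P` of `N` qubits that identifies
  the misalignment.  In a stream of encoded blocks, each with at most `tb` bit errors and at most
  `tp` phase errors, let `N` consecutive qubits be read with a misalignment `δ` of up to `al` qubits
  to the left or up to `ar` qubits to the right.  Then the measurement of these qubits yields the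
  outcome `δ` with certainty and leaves the state of the stream as it is. -/
  synchronization : ∃ P : ℤ → QubitOp (Fin N) (Fin N),
    (∀ δ, (P δ).IsHermitian ∧ P δ * P δ = P δ) ∧
    (∀ δ δ', δ ≠ δ' → P δ * P δ' = 0) ∧
    ∀ (B : ℕ) (e f : Fin B × Fin N → ZMod 2),
      (∀ i, hammingNorm (fun j => e (i, j)) ≤ tb ∧ hammingNorm (fun j => f (i, j)) ≤ tp) →
      ∀ (i : Fin B) (δ : ℤ) (w : Fin N → Fin B × Fin N),
        -(al : ℤ) ≤ δ → δ ≤ (ar : ℤ) → IsWindow i δ w →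
        onQubits w (P δ) * (pauli e f * streamEncoder B V) = pauli e f * streamEncoder B V

/-! The code is a CSS code, displaced by a fixed word and cyclically extended. Suppose C⊥ ⊆ C ⊆ D
are cyclic, and let `w` be the word of the generator of D. A basis state `s` is sent to the uniform
superposition over C⊥ + L s + w, where `L` picks coset representatives of C⊥ in C. Each word is
prolonged cyclically by `al` places on the left and `ar` on the right. All words used lie in D, so
bit errors are separated by the distance of D. Phase errors fold down to length n and are separated
by the distance of C, because a character sum over C⊥ vanishes unless its frequency lies in C. This
makes the encoded spaces after correctable errors mutually orthogonal (`cosetEncoder_orthonormal`),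
hence recoverable by one channel (`exists_recovery`).

A window misaligned by δ shows, in its middle n places, a word of C + `rotate δ w` up to few bit
errors. Diagonal projections onto the neighbourhoods of these cosets therefore reveal δ without
disturbing the state, provided that the rotations of `w` lie in different cosets of C
(`exists_isQSC_of_nested_cyclic`). If two rotations by d and d' agree modulo C, then every zero γ of
the generator of C that is not a zero of that of D satisfies γ^(d-d') = 1. There are m(t-u) such γ,
so |d-d'| would be at least m(t-u) (`rotate_generatorWord_injective`).

The BCH input is arithmetic. With n c = 2^m - 1 the bound on b becomes (b+2) c ≤ 2^⌈m/2⌉, so i 2^d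
stays below n for i ≤ b and d ≤ m/2, and congruences modulo n become equalities. Hence the
cyclotomic cosets of the odd i ≤ b are disjoint, have size m, and are never negatives of each other
(`coset_injective`, `coset_add_ne_zero`). This gives the number of zeros, 2m(t+1) ≤ n, and C⊥ ⊆ C.
-/

open Matrix Polynomial

/-! ### Signs -/

/-- The nontrivial additive character of `𝔽₂`, with complex values. -/
def bitSign (z : ZMod 2) : ℂ := (-1) ^ z.val

lemma bitSign_zero : bitSign 0 = 1 := by simp [bitSign]

lemma bitSign_one : bitSign 1 = -1 := by
  have h : (1 : ZMod 2).val = 1 := rfl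
  simp [bitSign, h]

lemma zmod_two_eq_zero_or_one (z : ZMod 2) : z = 0 ∨ z = 1 := by
  revert z; decide

lemma bitSign_add (z w : ZMod 2) : bitSign (z + w) = bitSign z * bitSign w := by
  have h2 : (1 : ZMod 2) + 1 = 0 := rfl
  rcases zmod_two_eq_zero_or_one z with rfl | rfl <;>
  rcases zmod_two_eq_zero_or_one w with rfl | rfl <;>
  simp [bitSign_zero, bitSign_one, h2]

lemma star_bitSign (z : ZMod 2) : star (bitSign z) = bitSign z := by
  simp [bitSign]

lemma add_self_fun {ι : Type*} (x : ι → ZMod 2) : x + x = 0 := by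
  funext i; exact CharTwo.add_self_eq_zero (x i)

lemma sub_eq_add_fun {ι : Type*} (x y : ι → ZMod 2) : x - y = x + y := by
  funext i; exact CharTwo.sub_eq_add (x i) (y i)

/-! ### The dual of a binary code -/

/-- The words orthogonal to all words of `C`. -/
def dualCode {n : ℕ} (C : Submodule (ZMod 2) (Fin n → ZMod 2)) :
    Submodule (ZMod 2) (Fin n → ZMod 2) :=
  C.dualAnnihilator.comap (dotProductEquiv (ZMod 2) (Fin n)).toLinearMap

lemma mem_dualCode {n : ℕ} {C : Submodule (ZMod 2) (Fin n → ZMod 2)} {x : Fin n → ZMod 2} :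
    x ∈ dualCode C ↔ ∀ c ∈ C, x ⬝ᵥ c = 0 := by
  simp [dualCode, Submodule.mem_dualAnnihilator]

lemma finrank_add_finrank_dualCode {n : ℕ} (C : Submodule (ZMod 2) (Fin n → ZMod 2)) :
    Module.finrank (ZMod 2) C + Module.finrank (ZMod 2) (dualCode C) = n := by
  have h := Subspace.finrank_add_finrank_dualAnnihilator_eq C
  have h2 : Module.finrank (ZMod 2) (dualCode C) = Module.finrank (ZMod 2) C.dualAnnihilator := by
    have : dualCode C = C.dualAnnihilator.map
        (dotProductEquiv (ZMod 2) (Fin n)).symm.toLinearMap := by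
      rw [dualCode, Submodule.map_equiv_eq_comap_symm]
      rfl
    rw [this]
    exact LinearEquiv.finrank_map_eq _ _
  rw [h2, h]
  simp

/-- A linear functional that kills `C` but not `x` is a dot product with some word; over 𝔽₂ its
nonzero value at `x` is 1. -/
lemma exists_dualCode_dotProduct_eq_one {n : ℕ} {C : Submodule (ZMod 2) (Fin n → ZMod 2)}
    {x : Fin n → ZMod 2} (hx : x ∉ C) : ∃ h ∈ dualCode C, x ⬝ᵥ h = 1 := by
  obtain ⟨f, hf, hC⟩ := Submodule.exists_le_ker_of_notMem hx
  refine ⟨(dotProductEquiv (ZMod 2) (Fin n)).symm f, mem_dualCode.2 fun c hc => ?_, ?_⟩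
  · have : (dotProductEquiv (ZMod 2) (Fin n)) ((dotProductEquiv (ZMod 2) (Fin n)).symm f) c = 0 := by
      rw [LinearEquiv.apply_symm_apply]; exact hC hc
    rwa [dotProductEquiv_apply_apply] at this
  · have : (dotProductEquiv (ZMod 2) (Fin n)) ((dotProductEquiv (ZMod 2) (Fin n)).symm f) x = f x := by
      rw [LinearEquiv.apply_symm_apply]
    rw [dotProduct_comm]
    rw [dotProductEquiv_apply_apply] at this
    rw [this]
    exact (zmod_two_eq_zero_or_one _).resolve_left hf

/-- A sum of signs over the dual code is zero unless the frequency is in the code. -/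
lemma sum_bitSign_dualCode {n : ℕ} {C : Submodule (ZMod 2) (Fin n → ZMod 2)}
    [Fintype (dualCode C)] {x : Fin n → ZMod 2} (hx : x ∉ C) :
    ∑ h : dualCode C, bitSign (x ⬝ᵥ (h : Fin n → ZMod 2)) = 0 := by
  obtain ⟨h₀, hh₀, h1⟩ := exists_dualCode_dotProduct_eq_one hx
  have key : ∑ h : dualCode C, bitSign (x ⬝ᵥ (h : Fin n → ZMod 2))
      = ∑ h : dualCode C, -bitSign (x ⬝ᵥ (h : Fin n → ZMod 2)) := by
    -- Translation by `h₀` permutes the dual code and flips every sign.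
    rw [← Equiv.sum_comp (Equiv.addRight (⟨h₀, hh₀⟩ : dualCode C))]
    refine Finset.sum_congr rfl fun h _ => ?_
    simp [dotProduct_add, bitSign_add, h1, bitSign_one]
  rw [Finset.sum_neg_distrib] at key
  exact self_eq_neg.1 key

/-- Coset representatives: a linear map into `C` that is injective modulo the subcode `H`. -/
lemma exists_linearMap_transversal {n k : ℕ} {C H : Submodule (ZMod 2) (Fin n → ZMod 2)}
    (hHC : H ≤ C) (hk : k + Module.finrank (ZMod 2) H ≤ Module.finrank (ZMod 2) C) :
    ∃ L : (Fin k → ZMod 2) →ₗ[ZMod 2] (Fin n → ZMod 2),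
      (∀ s, L s ∈ C) ∧ ∀ s, L s ∈ H → s = 0 := by
  obtain ⟨K, hK⟩ := Submodule.exists_isCompl (H.submoduleOf C)
  have h1 := Submodule.finrank_add_eq_of_isCompl hK
  have h2 : Module.finrank (ZMod 2) (H.submoduleOf C) = Module.finrank (ZMod 2) H :=
    (Submodule.submoduleOfEquivOfLe hHC).finrank_eq
  obtain ⟨f, hf⟩ := (finrank_le_iff_exists_linearMap (R := ZMod 2) (M := Fin k → ZMod 2)
    (M' := K)).1 (by rw [Module.finrank_fin_fun]; omega)
  refine ⟨C.subtype ∘ₗ K.subtype ∘ₗ f, fun s => (f s).1.2, fun s hs => ?_⟩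
  have h3 : (f s).1 ∈ H.submoduleOf C := hs
  have h4 : (f s).1 = 0 := by
    have := hK.disjoint.le_bot (Submodule.mem_inf.2 ⟨h3, (f s).2⟩)
    simpa using this
  have h5 : f s = 0 := Subtype.ext h4
  exact hf (by rw [h5, map_zero])

/-! ### Recovery from a family of orthonormal isometries -/

section Recovery

variable {m n ι : Type*} [Fintype m] [DecidableEq m] [Fintype n] [DecidableEq n]
  [Fintype ι]

/-- The projection onto the orthogonal complement of the ranges of a family of isometries. -/
def rangeComplement (W : ι → Matrix m n ℂ) : Matrix m m ℂ :=
  1 - ∑ i, W i * (W i).conjTranspose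

omit [Fintype m] [DecidableEq n] in
lemma conjTranspose_rangeComplement (W : ι → Matrix m n ℂ) :
    (rangeComplement W).conjTranspose = rangeComplement W := by
  simp [rangeComplement, conjTranspose_sub, conjTranspose_sum, conjTranspose_mul]

variable [DecidableEq ι]

lemma rangeComplement_mul {W : ι → Matrix m n ℂ}
    (hW : ∀ i j, (W i).conjTranspose * W j = if i = j then 1 else 0) (i : ι) :
    rangeComplement W * W i = 0 := by
  rw [rangeComplement, Matrix.sub_mul, Matrix.one_mul, Matrix.sum_mul, Finset.sum_eq_single i]
  · rw [Matrix.mul_assoc, hW, if_pos rfl, Matrix.mul_one, sub_self]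
  · intro j _ hj
    rw [Matrix.mul_assoc, hW, if_neg hj, Matrix.mul_zero]
  · simp

lemma rangeComplement_mul_self {W : ι → Matrix m n ℂ}
    (hW : ∀ i j, (W i).conjTranspose * W j = if i = j then 1 else 0) :
    rangeComplement W * rangeComplement W = rangeComplement W := by
  conv_lhs => arg 2; rw [rangeComplement]
  rw [Matrix.mul_sub, Matrix.mul_one, Matrix.mul_sum, Finset.sum_eq_zero, sub_zero]
  intro i _
  rw [← Matrix.mul_assoc, rangeComplement_mul hW, Matrix.zero_mul]

/-- The Kraus operators of the recovery: undo one of the isometries, or, on the complement of their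
ranges, reset to the basis vector `z`. -/
def recoveryKraus (z : n) (W : ι → Matrix m n ℂ) : ι ⊕ m → Matrix n m ℂ
  | .inl i => (W i).conjTranspose
  | .inr y => Matrix.single z y (1 : ℂ) * rangeComplement W

lemma sum_recoveryKraus (z : n) {W : ι → Matrix m n ℂ}
    (hW : ∀ i j, (W i).conjTranspose * W j = if i = j then 1 else 0) :
    ∑ x, (recoveryKraus z W x).conjTranspose * recoveryKraus z W x = 1 := by
  rw [Fintype.sum_sum_type]
  have h1 : ∀ y : m, (recoveryKraus z W (.inr y)).conjTranspose * recoveryKraus z W (.inr y)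
      = rangeComplement W * Matrix.single y y (1 : ℂ) * rangeComplement W := by
    intro y
    rw [recoveryKraus, conjTranspose_mul, conjTranspose_rangeComplement, conjTranspose_single,
      Matrix.mul_assoc, ← Matrix.mul_assoc (Matrix.single y z _), Matrix.single_mul_single_same,
      Matrix.mul_assoc, star_one, one_mul]
  simp only [h1]
  have h2 : ∑ y : m, Matrix.single y y (1 : ℂ) = 1 := by
    rw [Matrix.sum_single_eq_diagonal (fun _ : m => (1 : ℂ)), Matrix.diagonal_one]
  rw [← Matrix.sum_mul, ← Matrix.mul_sum, h2, Matrix.mul_one, rangeComplement_mul_self hW]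
  simp [recoveryKraus, rangeComplement]

lemma recoveryKraus_apply (z : n) {W : ι → Matrix m n ℂ}
    (hW : ∀ i j, (W i).conjTranspose * W j = if i = j then 1 else 0) (i : ι) (ρ : Matrix n n ℂ) :
    ∑ x, recoveryKraus z W x * (W i * ρ * (W i).conjTranspose) *
      (recoveryKraus z W x).conjTranspose = ρ := by
  have h1 : ∀ x, recoveryKraus z W x * (W i * ρ * (W i).conjTranspose) *
      (recoveryKraus z W x).conjTranspose
      = (recoveryKraus z W x * W i) * ρ * (recoveryKraus z W x * W i).conjTranspose := by
    intro x
    simp only [conjTranspose_mul, Matrix.mul_assoc]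
  have h2 : ∀ y, recoveryKraus z W (.inr y) * W i = 0 := by
    intro y
    rw [recoveryKraus, Matrix.mul_assoc, rangeComplement_mul hW, Matrix.mul_zero]
  have h3 : ∀ j, recoveryKraus z W (.inl j) * W i = if j = i then 1 else 0 := fun j => hW j i
  simp only [h1, Fintype.sum_sum_type, h2, h3]
  rw [Finset.sum_eq_single i]
  · simp
  · intro j _ hj
    simp [hj]
  · simp

/-- Isometries with mutually orthogonal ranges are undone by one quantum channel. -/
lemma exists_recovery (z : n) {W : ι → Matrix m n ℂ}
    (hW : ∀ i j, (W i).conjTranspose * W j = if i = j then 1 else 0) :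
    ∃ (J : ℕ) (R : Fin J → Matrix n m ℂ),
      ∑ j, (R j).conjTranspose * R j = 1 ∧
      ∀ i, ∀ ρ : Matrix n n ℂ,
        ∑ j, R j * (W i * ρ * (W i).conjTranspose) * (R j).conjTranspose = ρ := by
  refine ⟨Fintype.card (ι ⊕ m), fun j => recoveryKraus z W ((Fintype.equivFin _).symm j), ?_,
    fun i ρ => ?_⟩
  · rw [← sum_recoveryKraus z hW]
    exact Equiv.sum_comp (Fintype.equivFin _).symm
      fun x => (recoveryKraus z W x).conjTranspose * recoveryKraus z W x
  · refine Eq.trans ?_ (recoveryKraus_apply z hW i ρ)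
    exact Equiv.sum_comp (Fintype.equivFin _).symm
      fun x => recoveryKraus z W x * (W i * ρ * (W i).conjTranspose) *
        (recoveryKraus z W x).conjTranspose

end Recovery

/-! ### Superpositions over cosets of a linear code -/

section CosetEncoder

variable {n N k : ℕ}

/-- The encoder `|s⟩ ↦ |H|^{-1/2} ∑_{h ∈ H} |ι (h + L s + w)⟩`, followed by the phases
`(-1)^{φ · (h + L s + w)}` and the bit error `e`. -/
noncomputable def cosetEncoder (ι : (Fin n → ZMod 2) → (Fin N → ZMod 2))
    (H : Submodule (ZMod 2) (Fin n → ZMod 2)) [Fintype H]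
    (L : (Fin k → ZMod 2) → (Fin n → ZMod 2)) (w : Fin n → ZMod 2)
    (e : Fin N → ZMod 2) (φ : Fin n → ZMod 2) : QubitOp (Fin N) (Fin k) :=
  fun y s => ((Real.sqrt (Fintype.card H))⁻¹ : ℝ) *
    ∑ h : H, if y = ι (h + L s + w) + e then bitSign (φ ⬝ᵥ (h + L s + w)) else 0

variable {ι : (Fin n → ZMod 2) → (Fin N → ZMod 2)} {C D : Submodule (ZMod 2) (Fin n → ZMod 2)}
  {L : (Fin k → ZMod 2) →ₗ[ZMod 2] (Fin n → ZMod 2)} {w : Fin n → ZMod 2}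

lemma conjTranspose_cosetEncoder_mul {H : Submodule (ZMod 2) (Fin n → ZMod 2)} [Fintype H]
    (e e' : Fin N → ZMod 2) (φ φ' : Fin n → ZMod 2) (s s' : Fin k → ZMod 2) :
    ((cosetEncoder ι H L w e φ).conjTranspose * cosetEncoder ι H L w e' φ') s s'
      = (Fintype.card H : ℂ)⁻¹ * ∑ h : H, ∑ h' : H,
        if ι (h + L s + w) + e = ι (h' + L s' + w) + e' then
          bitSign (φ ⬝ᵥ (h + L s + w)) * bitSign (φ' ⬝ᵥ (h' + L s' + w)) else 0 := by
  have hc : (((Real.sqrt (Fintype.card H))⁻¹ : ℝ) : ℂ) * (((Real.sqrt (Fintype.card H))⁻¹ : ℝ) : ℂ)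
      = (Fintype.card H : ℂ)⁻¹ := by
    rw [← Complex.ofReal_mul, ← mul_inv, Real.mul_self_sqrt (by positivity)]
    simp
  rw [← hc, Matrix.mul_apply]
  have h1 : ∀ y, (cosetEncoder ι H L w e φ).conjTranspose s y * cosetEncoder ι H L w e' φ' y s'
      = ∑ h : H, ∑ h' : H, (((Real.sqrt (Fintype.card H))⁻¹ : ℝ) : ℂ) *
        (((Real.sqrt (Fintype.card H))⁻¹ : ℝ) : ℂ) *
        if y = ι (h + L s + w) + e then
          (if y = ι (h' + L s' + w) + e' then
            bitSign (φ ⬝ᵥ (h + L s + w)) * bitSign (φ' ⬝ᵥ (h' + L s' + w)) else 0) else 0 := by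
    intro y
    simp only [conjTranspose_apply, cosetEncoder, star_mul', star_sum, Complex.star_def,
      Complex.conj_ofReal]
    rw [mul_mul_mul_comm, Finset.sum_mul_sum, Finset.mul_sum]
    refine Finset.sum_congr rfl fun h _ => ?_
    rw [Finset.mul_sum]
    refine Finset.sum_congr rfl fun h' _ => ?_
    congr 1
    have := star_bitSign (φ ⬝ᵥ (h + L s + w))
    rw [Complex.star_def] at this
    split_ifs <;> simp only [this, map_zero, mul_zero, zero_mul]
  simp only [h1]
  rw [Finset.sum_comm, Finset.mul_sum]
  refine Finset.sum_congr rfl fun h _ => ?_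
  rw [Finset.sum_comm, Finset.mul_sum]
  refine Finset.sum_congr rfl fun h' _ => ?_
  rw [← Finset.mul_sum, Finset.sum_ite_eq' Finset.univ]
  simp

/-- Coset states with correctable errors are orthonormal. -/
lemma cosetEncoder_orthonormal [Fintype (dualCode C)] (hι : Function.Injective ι)
    (hL : ∀ s, L s ∈ dualCode C → s = 0)
    {e e' : Fin N → ZMod 2} {φ φ' : Fin n → ZMod 2}
    (he : ∀ h ∈ dualCode C, ∀ h' ∈ dualCode C, ∀ s s',
      ι (h + L s + w) + e = ι (h' + L s' + w) + e' → e = e')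
    (hφ : φ + φ' ∈ C → φ = φ') :
    (cosetEncoder ι (dualCode C) L w e φ).conjTranspose * cosetEncoder ι (dualCode C) L w e' φ'
      = if e = e' ∧ φ = φ' then 1 else 0 := by
  ext s s'
  rw [conjTranspose_cosetEncoder_mul]
  by_cases hee : e = e'
  · subst hee
    -- Different `s` give disjoint cosets of the dual code, so only identical terms can meet.
    have hiff : ∀ h h' : dualCode C, (ι (h + L s + w) + e = ι (h' + L s' + w) + e) ↔
        (h = h' ∧ s = s') := by
      refine fun h h' => ⟨fun heq => ?_, by rintro ⟨rfl, rfl⟩; rfl⟩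
      have h1 : (h : Fin n → ZMod 2) + L s = h' + L s' := add_right_cancel (hι (add_right_cancel heq))
      have h2 : L (s - s') = (h' : Fin n → ZMod 2) - h := by
        rw [map_sub, sub_eq_sub_iff_add_eq_add, add_comm, h1]
      have h3 : s = s' := sub_eq_zero.1 (hL _ (h2 ▸ sub_mem h'.2 h.2))
      subst h3
      exact ⟨Subtype.ext (add_right_cancel h1), rfl⟩
    have hR : (if e = e ∧ φ = φ' then (1 : QubitOp (Fin k) (Fin k)) else 0) s s'
        = if s = s' then (if φ = φ' then 1 else 0) else 0 := by
      by_cases hff : φ = φ' <;> simp [hff, Matrix.one_apply]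
    rw [hR]
    simp only [hiff]
    by_cases hs : s = s'
    · subst hs
      -- On the diagonal a character sum with frequency φ + φ' over the dual code remains.
      have h1 : ∀ h : dualCode C, (∑ h' : dualCode C, if h = h' ∧ True then
          bitSign (φ ⬝ᵥ (h + L s + w)) * bitSign (φ' ⬝ᵥ (h' + L s + w)) else 0)
          = bitSign ((φ + φ') ⬝ᵥ (L s + w)) * bitSign ((φ + φ') ⬝ᵥ (h : Fin n → ZMod 2)) := by
        intro h
        simp only [and_true]
        rw [Finset.sum_ite_eq Finset.univ, if_pos (Finset.mem_univ _), ← bitSign_add,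
          ← bitSign_add, ← add_dotProduct, ← dotProduct_add]
        congr 2
        abel
      simp only [h1, if_true]
      rw [← Finset.mul_sum]
      by_cases hff : φ = φ'
      · subst hff
        simp [add_self_fun, bitSign_zero]
      · rw [sum_bitSign_dualCode fun hmem => hff (hφ hmem)]
        simp [hff]
    · simp [hs]
  · rw [if_neg fun h => hee h.1]
    rw [Finset.sum_eq_zero, mul_zero, Matrix.zero_apply]
    intro h _
    refine Finset.sum_eq_zero fun h' _ => if_neg fun heq => hee (he _ h.2 _ h'.2 s s' heq)

/-- A Pauli error on a coset state is a bit error together with phases on the underlying words. -/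
lemma pauli_mul_cosetEncoder {H : Submodule (ZMod 2) (Fin n → ZMod 2)} [Fintype H]
    {e f : Fin N → ZMod 2} {φ : Fin n → ZMod 2} (hφ : ∀ x, f ⬝ᵥ ι x = φ ⬝ᵥ x) :
    pauli e f * cosetEncoder ι H L w 0 0 = cosetEncoder ι H L w e φ := by
  ext y s
  rw [Matrix.mul_apply]
  have h1 : ∀ x, pauli e f y x * cosetEncoder ι H L w 0 0 x s
      = ∑ h : H, (((Real.sqrt (Fintype.card H))⁻¹ : ℝ) : ℂ) * if x = ι (h + L s + w) then
        (if y = x + e then bitSign (f ⬝ᵥ x) else 0) else 0 := by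
    intro x
    simp only [cosetEncoder, pauli, add_zero, zero_dotProduct, bitSign_zero]
    rw [mul_left_comm, Finset.mul_sum, Finset.mul_sum]
    refine Finset.sum_congr rfl fun h _ => ?_
    simp [bitSign, dotProduct]
  simp only [h1]
  rw [Finset.sum_comm, cosetEncoder, Finset.mul_sum]
  refine Finset.sum_congr rfl fun h _ => ?_
  rw [← Finset.mul_sum, Finset.sum_ite_eq' Finset.univ, if_pos (Finset.mem_univ _), hφ]

lemma exists_of_cosetEncoder_ne_zero {H : Submodule (ZMod 2) (Fin n → ZMod 2)} [Fintype H]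
    {y : Fin N → ZMod 2} {s : Fin k → ZMod 2} (h : cosetEncoder ι H L w 0 0 y s ≠ 0) :
    ∃ x ∈ H, y = ι (x + L s + w) := by
  obtain ⟨x, -, hx⟩ := Finset.exists_ne_zero_of_sum_ne_zero (right_ne_zero_of_mul h)
  refine ⟨x, x.2, ?_⟩
  by_contra hne
  simp [hne] at hx

end CosetEncoder

/-! ### Cyclic shifts -/

section Rotation

variable {n : ℕ} [NeZero n]

/-- The residue of an integer modulo `n`, as an index. -/
def cyclicIndex (n : ℕ) [NeZero n] (z : ℤ) : Fin n :=
  ⟨(z % n).toNat, by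
    have h0 : (0 : ℤ) < n := by exact_mod_cast Nat.pos_of_neZero n
    have h1 := Int.emod_nonneg z h0.ne'
    have h2 := Int.emod_lt_of_pos z h0
    omega⟩

lemma cyclicIndex_coe (z : ℤ) : ((cyclicIndex n z : ℕ) : ℤ) = z % n := by
  have h0 : (0 : ℤ) < n := by exact_mod_cast Nat.pos_of_neZero n
  exact Int.toNat_of_nonneg (Int.emod_nonneg z h0.ne')

lemma cyclicIndex_eq_iff {z : ℤ} {l : Fin n} : cyclicIndex n z = l ↔ z % n = (l : ℕ) := by
  rw [← cyclicIndex_coe, Fin.ext_iff]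
  exact_mod_cast Iff.rfl

lemma cyclicIndex_natCast (l : Fin n) : cyclicIndex n (l : ℕ) = l := by
  rw [cyclicIndex_eq_iff]
  exact Int.emod_eq_of_lt (by positivity) (by exact_mod_cast l.2)

lemma cyclicIndex_cyclicIndex_add (z d : ℤ) :
    cyclicIndex n ((cyclicIndex n z : ℕ) + d) = cyclicIndex n (z + d) := by
  rw [cyclicIndex_eq_iff, cyclicIndex_coe, cyclicIndex_coe, Int.emod_add_emod]

/-- Rotation of the indices by `d`. -/
def cyclicIndexEquiv (n : ℕ) [NeZero n] (d : ℤ) : Fin n ≃ Fin n where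
  toFun l := cyclicIndex n ((l : ℕ) + d)
  invFun l := cyclicIndex n ((l : ℕ) + -d)
  left_inv l := by simp [cyclicIndex_cyclicIndex_add, cyclicIndex_natCast]
  right_inv l := by
    show cyclicIndex n ((cyclicIndex n _ : ℕ) + d) = l
    simp [cyclicIndex_cyclicIndex_add, cyclicIndex_natCast]

/-- The cyclic shift of a word by `d` places to the left. -/
def rotate (d : ℤ) : (Fin n → ZMod 2) →ₗ[ZMod 2] (Fin n → ZMod 2) where
  toFun x l := x (cyclicIndex n ((l : ℕ) + d))
  map_add' _ _ := rfl
  map_smul' _ _ := rfl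

lemma rotate_apply (d : ℤ) (x : Fin n → ZMod 2) (l : Fin n) :
    rotate d x l = x (cyclicIndex n ((l : ℕ) + d)) := rfl

/-- The cyclic extension of a word by `al` places to the left and `ar` places to the right. -/
def cyclicExtend (al ar : ℕ) (x : Fin n → ZMod 2) : Fin (n + al + ar) → ZMod 2 :=
  fun p => x (cyclicIndex n ((p : ℕ) - (al : ℤ)))

/-- The middle `n` places of an extended word. -/
def middle (al ar : ℕ) (y : Fin (n + al + ar) → ZMod 2) : Fin n → ZMod 2 :=
  fun l => y ⟨l + al, by omega⟩

omit [NeZero n] in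
lemma middle_add (al ar : ℕ) (y z : Fin (n + al + ar) → ZMod 2) :
    middle al ar (y + z) = middle al ar y + middle al ar z := rfl

lemma middle_cyclicExtend (al ar : ℕ) (x : Fin n → ZMod 2) :
    middle al ar (cyclicExtend al ar x) = x := by
  funext l
  simp [middle, cyclicExtend, cyclicIndex_natCast]

lemma cyclicExtend_injective (al ar : ℕ) :
    Function.Injective (cyclicExtend al ar : (Fin n → ZMod 2) → _) :=
  Function.LeftInverse.injective (middle_cyclicExtend al ar)

/-- The adjoint of the cyclic extension. -/
def cyclicFold (al ar : ℕ) (f : Fin (n + al + ar) → ZMod 2) : Fin n → ZMod 2 :=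
  fun l => ∑ p : Fin (n + al + ar), if cyclicIndex n ((p : ℕ) - (al : ℤ)) = l then f p else 0

/-- Phases on copies of the same place add up, so a phase error on the long word acts as its fold on
the underlying word. -/
lemma dotProduct_cyclicExtend (al ar : ℕ) (f : Fin (n + al + ar) → ZMod 2) (x : Fin n → ZMod 2) :
    f ⬝ᵥ cyclicExtend al ar x = cyclicFold al ar f ⬝ᵥ x := by
  simp only [dotProduct, cyclicFold, cyclicExtend, Finset.sum_mul, ite_mul, zero_mul]
  rw [Finset.sum_comm]
  simp

lemma hammingNorm_le_of_support {ι κ : Type*} [Fintype ι] [Fintype κ] {x : ι → ZMod 2}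
    {y : κ → ZMod 2} (g : κ → ι) (h : ∀ i, x i ≠ 0 → ∃ j, y j ≠ 0 ∧ g j = i) :
    hammingNorm x ≤ hammingNorm y := by
  classical
  refine le_trans (Finset.card_le_card (t := (Finset.univ.filter fun j => y j ≠ 0).image g) ?_)
    Finset.card_image_le
  intro i hi
  simpa using h i (by simpa using hi)

lemma hammingNorm_cyclicFold_le (al ar : ℕ) (f : Fin (n + al + ar) → ZMod 2) :
    hammingNorm (cyclicFold al ar f) ≤ hammingNorm f := by
  refine hammingNorm_le_of_support (fun p => cyclicIndex n ((p : ℕ) - (al : ℤ))) fun l hl => ?_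
  obtain ⟨p, -, hp⟩ := Finset.exists_ne_zero_of_sum_ne_zero hl
  by_cases h : cyclicIndex n ((p : ℕ) - (al : ℤ)) = l
  · exact ⟨p, by simpa [h] using hp, h⟩
  · simp [h] at hp

lemma hammingNorm_le_of_comp {ι κ : Type*} [Fintype ι] [Fintype κ] [Nonempty ι] {x : ι → ZMod 2}
    {y : κ → ZMod 2} (g : ι → κ) (hg : Function.Injective g) (hx : ∀ l, x l = y (g l)) :
    hammingNorm x ≤ hammingNorm y := by
  refine hammingNorm_le_of_support (Function.invFun g) fun l hl =>
    ⟨g l, by rwa [← hx], Function.leftInverse_invFun hg l⟩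

end Rotation

/-! ### Quantum synchronizable codes from nested cyclic codes -/

/-- A diagonal measurement only sees which basis strings occur. Phase errors are therefore invisible
to it, and each string can be checked separately. -/
lemma onQubits_diagonal_mul {S T : Type*} [Fintype S] [DecidableEq S] {N : ℕ} (w : Fin N → S)
    (p : (Fin N → ZMod 2) → ℂ) {M : QubitOp S T} (h : ∀ x y, M x y ≠ 0 → p (x ∘ w) = 1) :
    onQubits w (Matrix.diagonal p) * M = M := by
  have hd : onQubits w (Matrix.diagonal p) = Matrix.diagonal fun x => p (x ∘ w) := by
    ext y x
    rw [onQubits, Matrix.diagonal_apply, Matrix.diagonal_apply]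
    by_cases hyx : y = x
    · subst hyx; simp
    · rw [if_neg hyx]
      split_ifs with h1 h2
      · refine absurd (funext fun s => ?_) hyx
        by_cases hs : s ∈ Set.range w
        · obtain ⟨j, rfl⟩ := hs
          exact congrFun h2 j
        · exact h1 s hs
      · rfl
      · rfl
  rw [hd]
  ext x y
  rw [Matrix.diagonal_mul]
  by_cases hM : M x y = 0
  · rw [hM, mul_zero]
  · rw [h x y hM, one_mul]

lemma exists_of_pauli_mul_ne_zero {S T : Type*} [Fintype S] [DecidableEq S] {e f : S → ZMod 2}
    {M : QubitOp S T} {x : S → ZMod 2} {y : T → ZMod 2} (h : (pauli e f * M) x y ≠ 0) :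
    ∃ z, M z y ≠ 0 ∧ x = z + e := by
  rw [Matrix.mul_apply] at h
  obtain ⟨z, -, hz⟩ := Finset.exists_ne_zero_of_sum_ne_zero h
  refine ⟨z, right_ne_zero_of_mul hz, ?_⟩
  by_contra hne
  simp [pauli, hne] at hz

/-- A window with misalignment `δ` meets the block with its `N` places shifted by `δ`. -/
lemma IsWindow.apply_eq {B N : ℕ} {i : Fin B} {δ : ℤ} {w : Fin N → Fin B × Fin N}
    (hw : IsWindow i δ w) {j j' : Fin N} (h : ((j' : ℕ) : ℤ) = (j : ℕ) + δ) : w j = (i, j') := by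
  have h1 := hw j
  have h2 : (((w j).1 : ℕ) : ℤ) * N + ((w j).2 : ℕ) = (i : ℕ) * N + (j' : ℕ) := by
    rw [h1, h]; ring
  have h3 : ((w j).1 : ℕ) * N + ((w j).2 : ℕ) = (i : ℕ) * N + (j' : ℕ) := by exact_mod_cast h2
  have hN : 0 < N := j.pos
  have h4 : ((w j).1 : ℕ) = i := by
    have := congrArg (· / N) h3
    simpa [Nat.mul_comm _ N, Nat.mul_add_div hN, Nat.div_eq_of_lt (w j).2.2,
      Nat.div_eq_of_lt j'.2] using this
  refine Prod.ext (Fin.ext h4) (Fin.ext ?_)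
  rw [h4] at h3
  exact Nat.add_left_cancel h3

/-- Unique decoding by the triangle inequality. It serves bit errors, phase errors and misalignment
alike. -/
lemma eq_of_hammingNorm_sub_le {n t : ℕ} {D : Submodule (ZMod 2) (Fin n → ZMod 2)}
    (hD : ∀ x ∈ D, x ≠ 0 → 2 * t < hammingNorm x) {x x' y : Fin n → ZMod 2}
    (hx : x - x' ∈ D) (h : hammingNorm (y - x) ≤ t) (h' : hammingNorm (y - x') ≤ t) : x = x' := by
  by_contra hne
  have h1 := hD _ hx (sub_ne_zero.2 hne)
  have h2 := hammingDist_triangle x y x'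
  rw [hammingDist_eq_hammingNorm, hammingDist_eq_hammingNorm, hammingDist_eq_hammingNorm] at h2
  have h3 : -x + x' = x - x' := by rw [sub_eq_add_fun, ZModModule.neg_eq_self]
  have h4 : -x + y = y - x := by abel
  have h5 : -y + x' = y - x' := by rw [sub_eq_add_fun, ZModModule.neg_eq_self]
  rw [h3, h4, h5] at h2
  omega

section Synchronization

variable {n : ℕ} [NeZero n]

/-- The basis states whose middle part is within distance `t` of the coset `w + C`, where `w` is
rotated by `δ`. -/
noncomputable def nearCoset (C : Submodule (ZMod 2) (Fin n → ZMod 2)) (w : Fin n → ZMod 2)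
    (al ar t : ℕ) (δ : ℤ) (y : Fin (n + al + ar) → ZMod 2) : ℂ :=
  open Classical in
  -- Outside the admissible range the projection is zero, so that orthogonality holds for all pairs
  -- of distinct integers.
  if -(al : ℤ) ≤ δ ∧ δ ≤ (ar : ℤ) ∧
    ∃ c ∈ C, hammingNorm (middle al ar y - (rotate δ w + c)) ≤ t then 1 else 0

lemma nearCoset_mul_self (C : Submodule (ZMod 2) (Fin n → ZMod 2)) (w : Fin n → ZMod 2)
    (al ar t : ℕ) (δ : ℤ) (y : Fin (n + al + ar) → ZMod 2) :
    nearCoset C w al ar t δ y * nearCoset C w al ar t δ y = nearCoset C w al ar t δ y := by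
  rw [nearCoset]; split_ifs <;> simp

/-- A string near both cosets would be near two words of `D`, which must coincide; then the two
rotations of `w` agree modulo `C`. -/
lemma nearCoset_mul_of_ne {C D : Submodule (ZMod 2) (Fin n → ZMod 2)} (hCD : C ≤ D)
    (hrot : ∀ d, ∀ x ∈ D, rotate d x ∈ D) {w : Fin n → ZMod 2} (hw : w ∈ D) {al ar t : ℕ}
    (hsep : ∀ d d' : ℤ, -(al : ℤ) ≤ d → d ≤ ar → -(al : ℤ) ≤ d' → d' ≤ ar →
      rotate d w - rotate d' w ∈ C → d = d')
    (ht : ∀ x ∈ D, x ≠ 0 → 2 * t < hammingNorm x) {δ δ' : ℤ} (hδ : δ ≠ δ')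
    (y : Fin (n + al + ar) → ZMod 2) :
    nearCoset C w al ar t δ y * nearCoset C w al ar t δ' y = 0 := by
  rw [nearCoset, nearCoset]
  split_ifs with h1 h2
  · obtain ⟨ha, hb, c, hc, hcn⟩ := h1
    obtain ⟨ha', hb', c', hc', hcn'⟩ := h2
    refine absurd (hsep δ δ' ha hb ha' hb' ?_) hδ
    have := eq_of_hammingNorm_sub_le ht
      (sub_mem (add_mem (hrot δ w hw) (hCD hc)) (add_mem (hrot δ' w hw) (hCD hc'))) hcn hcn'
    have h3 : rotate δ w - rotate δ' w = c' - c := by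
      rw [sub_eq_sub_iff_add_eq_add, this, add_comm]
    rw [h3]
    exact sub_mem hc' hc
  all_goals simp

/-- Reading a window of a stream of extended codewords with few bit errors. -/
lemma nearCoset_window {C : Submodule (ZMod 2) (Fin n → ZMod 2)}
    (hrot : ∀ d, ∀ x ∈ C, rotate d x ∈ C) {w : Fin n → ZMod 2} {al ar t B : ℕ}
    {e z : Fin B × Fin (n + al + ar) → ZMod 2} {i : Fin B}
    (he : hammingNorm (fun j => e (i, j)) ≤ t)
    (hz : ∃ x ∈ C, (fun j => z (i, j)) = cyclicExtend al ar (x + w)) {δ : ℤ}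
    (h1 : -(al : ℤ) ≤ δ) (h2 : δ ≤ ar) {v : Fin (n + al + ar) → Fin B × Fin (n + al + ar)}
    (hv : IsWindow i δ v) :
    nearCoset C w al ar t δ ((z + e) ∘ v) = 1 := by
  obtain ⟨x, hx, hzx⟩ := hz
  refine if_pos ⟨h1, h2, rotate δ x, hrot δ x hx, le_trans ?_ he⟩
  -- The margins absorb the misalignment: the middle part of the window stays inside block `i`.
  have hlt : ∀ l : Fin n, ((l : ℕ) + al + δ).toNat < n + al + ar := fun l => by
    have := l.2; omega
  have hcast : ∀ l : Fin n, (((l : ℕ) + al + δ).toNat : ℤ) = (l : ℕ) + al + δ := fun l => by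
    omega
  refine hammingNorm_le_of_comp (fun l : Fin n => ⟨((l : ℕ) + al + δ).toNat, hlt l⟩)
    (fun l l' hll => ?_) fun l => ?_
  · have h3 := congrArg (fun q : Fin (n + al + ar) => ((q : ℕ) : ℤ)) hll
    simp only [hcast] at h3
    exact Fin.ext (by omega)
  · have hvl : v ⟨l + al, by omega⟩ = (i, ⟨((l : ℕ) + al + δ).toNat, hlt l⟩) :=
      hv.apply_eq (by simp only [hcast]; push_cast; ring)
    have hzl := congrFun hzx ⟨((l : ℕ) + al + δ).toNat, hlt l⟩
    have hidx : ((((l : ℕ) + al + δ).toNat : ℕ) : ℤ) - (al : ℤ) = (l : ℕ) + δ := by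
      rw [hcast]; ring
    simp only [cyclicExtend, hidx] at hzl
    simp only [Pi.sub_apply, Pi.add_apply, middle, Function.comp_apply, hvl, hzl, rotate_apply]
    ring

/-- The synchronizable code of two nested cyclic codes `C ≤ D` such that `C` contains its dual: the
words of `D` in one coset of `C` that is moved by all cyclic shifts up to the misalignment. -/
theorem exists_isQSC_of_nested_cyclic {C D : Submodule (ZMod 2) (Fin n → ZMod 2)}
    {k al ar tp tb : ℕ} (hdual : dualCode C ≤ C) (hCD : C ≤ D)
    (hrotC : ∀ d, ∀ x ∈ C, rotate d x ∈ C) (hrotD : ∀ d, ∀ x ∈ D, rotate d x ∈ D)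
    {w : Fin n → ZMod 2} (hw : w ∈ D)
    (hsep : ∀ d d' : ℤ, -(al : ℤ) ≤ d → d ≤ ar → -(al : ℤ) ≤ d' → d' ≤ ar →
      rotate d w - rotate d' w ∈ C → d = d')
    (hk : k + n ≤ 2 * Module.finrank (ZMod 2) C)
    (htp : ∀ x ∈ C, x ≠ 0 → 2 * tp < hammingNorm x)
    (htb : ∀ x ∈ D, x ≠ 0 → 2 * tb < hammingNorm x) :
    ∃ V : QubitOp (Fin (n + al + ar)) (Fin k), IsQSC V al ar tp tb := by
  classical
  have : Fintype (dualCode C) := Fintype.ofFinite _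
  have hdim := finrank_add_finrank_dualCode C
  -- The hypothesis `hk` says that k ≤ dim C - dim C⊥.
  obtain ⟨L, hLC, hL⟩ := exists_linearMap_transversal (k := k) hdual (by omega)
  set W := cosetEncoder (cyclicExtend al ar) (dualCode C) L w with hW
  have hmemD : ∀ h ∈ dualCode C, ∀ s, h + L s + w ∈ D := fun h hh s =>
    add_mem (hCD (add_mem (hdual hh) (hLC s))) hw
  have horth : ∀ (e e' : Fin (n + al + ar) → ZMod 2) (φ φ' : Fin n → ZMod 2),
      hammingNorm e ≤ tb → hammingNorm e' ≤ tb → hammingNorm φ ≤ tp → hammingNorm φ' ≤ tp →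
      (W e φ).conjTranspose * W e' φ' = if e = e' ∧ φ = φ' then 1 else 0 := by
    intro e e' φ φ' he he' hφ hφ'
    refine cosetEncoder_orthonormal (cyclicExtend_injective al ar) hL ?_ ?_
    · intro h hh h' hh' s s' heq
      -- The middle parts determine the word by unique decoding in `D`; cancelling it identifies the
      -- bit errors on all the qubits, margins included.
      have hm : h + L s + w + middle al ar e = h' + L s' + w + middle al ar e' := by
        have := congrArg (middle al ar) heq
        simpa only [middle_add, middle_cyclicExtend] using this
      have hle : ∀ f : Fin (n + al + ar) → ZMod 2, hammingNorm (middle al ar f) ≤ hammingNorm f :=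
        fun f => hammingNorm_le_of_comp (fun l : Fin n => ⟨l + al, by omega⟩)
          (fun l l' hll => Fin.ext (by simpa using hll)) fun l => rfl
      have heq2 := eq_of_hammingNorm_sub_le htb
        (y := h + L s + w + middle al ar e)
        (sub_mem (hmemD h hh s) (hmemD h' hh' s'))
        (by rw [add_sub_cancel_left]; exact (hle e).trans he)
        (by rw [hm, add_sub_cancel_left]; exact (hle e').trans he')
      rw [heq2] at heq
      exact add_left_cancel heq
    · intro hmem
      refine eq_of_hammingNorm_sub_le htp (y := 0) (by rwa [sub_eq_add_fun]) ?_ ?_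
      · rwa [zero_sub, ZModModule.neg_eq_self]
      · rwa [zero_sub, ZModModule.neg_eq_self]
  refine ⟨W 0 0, ?_, ?_, ?_⟩
  · rw [horth 0 0 0 0 (by simp) (by simp) (by simp) (by simp), if_pos ⟨rfl, rfl⟩]
  -- Phase errors with the same fold act identically, so the orthonormal family is indexed by the
  -- folded pattern.
  · let I := {p : (Fin (n + al + ar) → ZMod 2) × (Fin n → ZMod 2) //
      hammingNorm p.1 ≤ tb ∧ hammingNorm p.2 ≤ tp}
    obtain ⟨J, R, hR1, hR2⟩ := exists_recovery (ι := I) (0 : Fin k → ZMod 2)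
      (W := fun p => W p.1.1 p.1.2) (fun p q => by
        rw [horth _ _ _ _ p.2.1 q.2.1 p.2.2 q.2.2]
        exact if_congr (by rw [Subtype.ext_iff, Prod.ext_iff]) rfl rfl)
    refine ⟨J, R, hR1, fun e f he hf ρ => ?_⟩
    rw [hW, pauli_mul_cosetEncoder (dotProduct_cyclicExtend al ar f)]
    exact hR2 ⟨(e, cyclicFold al ar f), he, (hammingNorm_cyclicFold_le al ar f).trans hf⟩ ρ
  · refine ⟨fun δ => Matrix.diagonal (nearCoset C w al ar tb δ), fun δ => ⟨?_, ?_⟩, ?_, ?_⟩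
    · rw [Matrix.IsHermitian, diagonal_conjTranspose]
      congr 1
      funext y
      simp only [Pi.star_apply, nearCoset]
      split_ifs <;> simp
    · rw [diagonal_mul_diagonal]
      congr 1
      funext y
      exact nearCoset_mul_self ..
    · intro δ δ' hδ
      rw [diagonal_mul_diagonal, ← diagonal_zero]
      congr 1
      funext y
      exact nearCoset_mul_of_ne hCD hrotD hw hsep htb hδ y
    · intro B e f hef i δ v h1 h2 hv
      refine onQubits_diagonal_mul v _ fun x y hxy => ?_
      obtain ⟨z, hz, rfl⟩ := exists_of_pauli_mul_ne_zero hxy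
      refine nearCoset_window hrotC (hef i).1 ?_ h1 h2 hv
      obtain ⟨h, hh, heq⟩ := exists_of_cosetEncoder_ne_zero
        (Finset.prod_ne_zero_iff.1 hz i (Finset.mem_univ _))
      exact ⟨h + L (fun j => y (i, j)), add_mem (hdual hh) (hLC _), heq⟩

end Synchronization

/-! ### Cyclotomic cosets of small integers -/

/-- The arithmetic facts on the length `n`, the order `m` of `2` modulo `n`, and the design distance
that the bounds of the theorem provide: `n * c = 2 ^ m - 1`, and `(b + 2) * c ≤ 2 ^ h`, where `h` is
`m / 2` rounded up. -/
structure IsCosetBound (n m c h b : ℕ) : Prop where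
  ord_eq : orderOf (2 : ZMod n) = m
  pos : 0 < m
  mul_eq : n * c + 1 = 2 ^ m
  half_add : h + m / 2 ≤ m
  half_le : h ≤ m / 2 + 1
  le : (b + 2) * c ≤ 2 ^ h

namespace IsCosetBound

variable {n m c h b : ℕ}

lemma cofactor_pos (H : IsCosetBound n m c h b) : 0 < c := by
  rcases Nat.eq_zero_or_pos c with hc | hc
  · have := H.mul_eq
    have h2 : 2 ≤ 2 ^ m := by
      calc 2 = 2 ^ 1 := rfl
        _ ≤ 2 ^ m := Nat.pow_le_pow_right (by norm_num) H.pos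
    subst hc
    omega
  · exact hc

lemma length_pos (H : IsCosetBound n m c h b) : 0 < n := by
  rcases Nat.eq_zero_or_pos n with hc | hc
  · have := H.mul_eq
    have h2 : 2 ≤ 2 ^ m := by
      calc 2 = 2 ^ 1 := rfl
        _ ≤ 2 ^ m := Nat.pow_le_pow_right (by norm_num) H.pos
    subst hc
    omega
  · exact hc

lemma two_pow_half_mul_le (H : IsCosetBound n m c h b) : 2 ^ h * 2 ^ (m / 2) ≤ 2 ^ m := by
  rw [← pow_add]
  exact Nat.pow_le_pow_right (by norm_num) H.half_add

lemma two_pow_le (H : IsCosetBound n m c h b) : 2 ^ h ≤ 2 * 2 ^ (m / 2) := by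
  rw [← pow_succ']
  exact Nat.pow_le_pow_right (by norm_num) H.half_le

lemma mul_cofactor_add_two_le (H : IsCosetBound n m c h b) {i : ℕ} (hi : i ≤ b) :
    i * c + 2 ≤ 2 ^ h := by
  have h1 := H.le
  have h2 := H.cofactor_pos
  nlinarith [Nat.mul_le_mul_right c hi]

/-- Multiplied by `c`, the modulus becomes 2^m - 1. The margin 2 · 2^(m/2) leaves room for a second
summand in `add_ne_zero_of_le_half`. -/
lemma mul_two_pow_mul_lt (H : IsCosetBound n m c h b) {i d : ℕ} (hi : i ≤ b) (hd : d ≤ m / 2) :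
    i * 2 ^ d * c + 2 * 2 ^ (m / 2) ≤ 2 ^ m := by
  have h1 := H.mul_cofactor_add_two_le hi
  have h2 : 2 ^ d ≤ 2 ^ (m / 2) := Nat.pow_le_pow_right (by norm_num) hd
  calc i * 2 ^ d * c + 2 * 2 ^ (m / 2) = i * c * 2 ^ d + 2 * 2 ^ (m / 2) := by ring
    _ ≤ i * c * 2 ^ (m / 2) + 2 * 2 ^ (m / 2) := by gcongr
    _ = (i * c + 2) * 2 ^ (m / 2) := by ring
    _ ≤ 2 ^ h * 2 ^ (m / 2) := by gcongr
    _ ≤ 2 ^ m := H.two_pow_half_mul_le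

lemma two_pow_eq_one (H : IsCosetBound n m c h b) : (2 : ZMod n) ^ m = 1 := by
  rw [← H.ord_eq]; exact pow_orderOf_eq_one _

/-- Both sides are represented by integers below `n`, so they are equal as integers; since `j` is
odd, no factor 2 can occur. -/
lemma eq_of_le_half (H : IsCosetBound n m c h b) {i j d : ℕ} (hib : i ≤ b)
    (hjb : j ≤ b) (hj : Odd j) (hd : d ≤ m / 2)
    (heq : (i : ZMod n) * 2 ^ d = j) : d = 0 ∧ i = j := by
  have hp := Nat.two_pow_pos (m / 2)
  have h1 : i * 2 ^ d < n := by
    have := H.mul_two_pow_mul_lt hib hd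
    have h2 := H.mul_eq
    exact Nat.lt_of_mul_lt_mul_right (a := c) (by omega)
  have h2 : j < n := by
    have := H.mul_two_pow_mul_lt hjb (Nat.zero_le _)
    have h2 := H.mul_eq
    exact Nat.lt_of_mul_lt_mul_right (a := c) (by simp at this; omega)
  have h3 : ((i * 2 ^ d : ℕ) : ZMod n) = (j : ℕ) := by push_cast; exact heq
  rw [ZMod.natCast_eq_natCast_iff] at h3
  have h4 : i * 2 ^ d = j := Nat.ModEq.eq_of_lt_of_lt h3 h1 h2
  have h5 : d = 0 := by
    by_contra hd0
    rw [← h4] at hj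
    exact (Nat.not_odd_iff_even.2 ((Nat.even_pow.2 ⟨even_two, hd0⟩).mul_left i)) hj
  subst h5
  exact ⟨rfl, by simpa using h4⟩

lemma eq_of_mul_two_pow_eq (H : IsCosetBound n m c h b) {i j d : ℕ} (hib : i ≤ b)
    (hi : Odd i) (hjb : j ≤ b) (hj : Odd j) (hd : d < m)
    (heq : (i : ZMod n) * 2 ^ d = j) : d = 0 ∧ i = j := by
  by_cases hdm : d ≤ m / 2
  · exact H.eq_of_le_half hib hjb hj hdm heq
  -- For large `d`, multiplication by 2^(m-d) exchanges `i` and `j` and leaves a short shift.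
  · have h1 : (j : ZMod n) * 2 ^ (m - d) = i := by
      rw [← heq, mul_assoc, ← pow_add, Nat.add_sub_cancel' hd.le, H.two_pow_eq_one, mul_one]
    have := (H.eq_of_le_half hjb hib hi (by omega) h1).1
    omega

lemma isUnit_two_pow (H : IsCosetBound n m c h b) (s : ℕ) : IsUnit ((2 : ZMod n) ^ s) :=
  (IsUnit.of_pow_eq_one H.two_pow_eq_one H.pos.ne').pow s

/-- The cyclotomic cosets of the odd numbers up to `b` are disjoint and have size `m`. -/
lemma coset_injective (H : IsCosetBound n m c h b) {i j s s' : ℕ} (hib : i ≤ b) (hi : Odd i)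
    (hjb : j ≤ b) (hj : Odd j) (hs : s < m) (hs' : s' < m)
    (heq : (i : ZMod n) * 2 ^ s = j * 2 ^ s') : i = j ∧ s = s' := by
  wlog hle : s' ≤ s generalizing i j s s'
  · have := this hjb hj hib hi hs' hs heq.symm (by omega)
    exact ⟨this.1.symm, this.2.symm⟩
  have h1 : (i : ZMod n) * 2 ^ (s - s') = j := by
    refine (H.isUnit_two_pow s').mul_right_cancel ?_
    rw [mul_assoc, ← pow_add, Nat.sub_add_cancel hle, heq]
  have := H.eq_of_mul_two_pow_eq hib hi hjb hj (by omega) h1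
  exact ⟨this.2, by omega⟩

/-- The representing integer lies strictly between 0 and `n`. -/
lemma add_ne_zero_of_le_half (H : IsCosetBound n m c h b) {i j d : ℕ}
    (hib : i ≤ b) (hj1 : 1 ≤ j) (hjb : j ≤ b) (hd : d ≤ m / 2) :
    (i : ZMod n) * 2 ^ d + j ≠ 0 := by
  intro heq
  have h3 : ((i * 2 ^ d + j : ℕ) : ZMod n) = 0 := by push_cast; exact heq
  rw [ZMod.natCast_eq_zero_iff] at h3
  have h4 : i * 2 ^ d + j < n := by
    have h5 := H.mul_two_pow_mul_lt hib hd
    have h6 := H.mul_cofactor_add_two_le hjb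
    have h7 := H.two_pow_le
    have h8 := H.mul_eq
    refine Nat.lt_of_mul_lt_mul_right (a := c) ?_
    rw [add_mul]
    omega
  have := Nat.le_of_dvd (by omega) h3
  omega

/-- No cyclotomic coset of a number up to `b` is the negative of another. -/
lemma coset_add_ne_zero (H : IsCosetBound n m c h b) {i j s s' : ℕ} (hi1 : 1 ≤ i)
    (hib : i ≤ b) (hj1 : 1 ≤ j) (hjb : j ≤ b) (hs : s < m) (hs' : s' < m) :
    (i : ZMod n) * 2 ^ s + j * 2 ^ s' ≠ 0 := by
  wlog hle : s' ≤ s generalizing i j s s'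
  · rw [add_comm]
    exact this hj1 hjb hi1 hib hs' hs (by omega)
  intro heq
  have h1 : (i : ZMod n) * 2 ^ (s - s') + j = 0 := by
    refine (H.isUnit_two_pow s').mul_right_cancel ?_
    rw [add_mul, mul_assoc, ← pow_add, Nat.sub_add_cancel hle, heq, zero_mul]
  by_cases hd : s - s' ≤ m / 2
  · exact H.add_ne_zero_of_le_half hib hj1 hjb hd h1
  · refine H.add_ne_zero_of_le_half (d := m - (s - s')) hjb hi1 hib (by omega) ?_
    have h2 : ((i : ZMod n) * 2 ^ (s - s') + j) * 2 ^ (m - (s - s')) = 0 := by rw [h1, zero_mul]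
    rwa [add_mul, mul_assoc, ← pow_add, Nat.add_sub_cancel' (by omega), H.two_pow_eq_one, mul_one,
      add_comm] at h2

/-- The bounds of the theorem. -/
lemma of_design_lt {n m b : ℕ} (hn : 3 ≤ n) (hm : m = orderOf (2 : ZMod n)) (hupp : n ≤ 2 ^ m - 1)
    (hb : (b : ℤ) < ⌊(n : ℚ) * 2 ^ ⌈(m : ℚ) / 2⌉₊ / (2 ^ m - 1) - 1⌋) :
    ∃ c h, IsCosetBound n m c h b := by
  have hm0 : 0 < m := by
    rcases Nat.eq_zero_or_pos m with h | h
    · subst h; simp at hupp; omega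
    · exact h
  have h1 : (2 : ZMod n) ^ m = 1 := by rw [hm]; exact pow_orderOf_eq_one _
  have h2 : n ∣ 2 ^ m - 1 := by
    rw [← Nat.modEq_iff_dvd' (by omega), ← ZMod.natCast_eq_natCast_iff]
    push_cast; exact h1.symm
  obtain ⟨c, hc⟩ := h2
  have hpm : n * c + 1 = 2 ^ m := by omega
  have hc0 : 0 < c := by
    rcases Nat.eq_zero_or_pos c with h | h
    · subst h; omega
    · exact h
  set h := ⌈(m : ℚ) / 2⌉₊ with hh
  have hlt : (h : ℚ) < m / 2 + 1 := Nat.ceil_lt_add_one (by positivity)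
  have hlt' : 2 * h < m + 2 := by
    have : (2 : ℚ) * h < m + 2 := by linarith
    exact_mod_cast this
  refine ⟨c, h, hm.symm, hm0, hpm, by omega, by omega, ?_⟩
  -- Strict inequality of integers gains one and the -1 inside the floor another: this is the 2 in
  -- (b + 2) c ≤ 2^h.
  have h3 : ((b + 1 : ℤ) : ℚ) ≤ (n : ℚ) * 2 ^ h / (2 ^ m - 1) - 1 := Int.le_floor.1 hb
  have hpq : (2 : ℚ) ^ m - 1 = n * c := by
    have : ((n * c + 1 : ℕ) : ℚ) = ((2 ^ m : ℕ) : ℚ) := by rw [hpm]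
    push_cast at this
    linarith
  have hnq : (0 : ℚ) < n := by exact_mod_cast (by omega : 0 < n)
  have hcq : (0 : ℚ) < c := by exact_mod_cast hc0
  rw [hpq, mul_div_mul_left _ _ hnq.ne'] at h3
  have h4 : ((b : ℚ) + 2) ≤ 2 ^ h / c := by push_cast at h3; linarith
  rw [le_div_iff₀ hcq] at h4
  exact_mod_cast h4

end IsCosetBound

/-! ### Polynomials of binary words -/

section WordPoly

variable {F : Type*} [Field F] [Algebra (ZMod 2) F] {n : ℕ}

lemma wordPoly_add (c d : Fin n → ZMod 2) : wordPoly (c + d) = wordPoly c + wordPoly d := by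
  simp [wordPoly, Finset.sum_add_distrib]

lemma wordPoly_smul (r : ZMod 2) (c : Fin n → ZMod 2) : wordPoly (r • c) = r • wordPoly c := by
  simp [wordPoly, Finset.smul_sum, smul_monomial]

lemma wordPoly_sub (c d : Fin n → ZMod 2) : wordPoly (c - d) = wordPoly c - wordPoly d := by
  simp [wordPoly, Finset.sum_sub_distrib]

lemma mem_cyclicCode {g : (ZMod 2)[X]} {c : Fin n → ZMod 2} :
    c ∈ cyclicCode n g ↔ g ∣ wordPoly c := Iff.rfl

lemma aeval_wordPoly (β : F) (c : Fin n → ZMod 2) :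
    aeval β (wordPoly c) = ∑ l : Fin n, algebraMap (ZMod 2) F (c l) * β ^ (l : ℕ) := by
  simp [wordPoly, aeval_monomial]

lemma wordPoly_coeff {g : (ZMod 2)[X]} (hg : g.natDegree < n) :
    wordPoly (fun l : Fin n => g.coeff l) = g := by
  conv_rhs => rw [g.as_sum_range' n hg]
  rw [wordPoly, Fin.sum_univ_eq_sum_range (fun l => monomial l (g.coeff l))]

/-- The codimension of a cyclic code is at most the degree of its generator. -/
lemma le_finrank_cyclicCode_add_natDegree {g : (ZMod 2)[X]} (hg : g ≠ 0) :
    n ≤ Module.finrank (ZMod 2) (cyclicCode n g) + g.natDegree := by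
  -- The code is the kernel of reduction modulo `g`, whose target has dimension deg g.
  let φ : (Fin n → ZMod 2) →ₗ[ZMod 2] AdjoinRoot g :=
    (AdjoinRoot.mkₐ g).toLinearMap.restrictScalars (ZMod 2) ∘ₗ
      { toFun := wordPoly, map_add' := wordPoly_add, map_smul' := wordPoly_smul }
  have hker : φ.ker = cyclicCode n g := by
    ext c
    rw [LinearMap.mem_ker, mem_cyclicCode, ← AdjoinRoot.mk_eq_zero]
    rfl
  have h1 := φ.finrank_range_add_finrank_ker
  rw [hker, Module.finrank_fin_fun] at h1
  have : Module.Finite (ZMod 2) (AdjoinRoot g) := (AdjoinRoot.powerBasis hg).finite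
  have h2 := Submodule.finrank_le φ.range
  rw [(AdjoinRoot.powerBasis hg).finrank, AdjoinRoot.powerBasis_dim] at h2
  omega

variable [NeZero n]

omit [Algebra (ZMod 2) F] in
lemma zpow_cyclicIndex {β : F} (hβ : β ^ n = 1) (z : ℤ) :
    β ^ ((cyclicIndex n z : ℕ)) = β ^ z := by
  rw [← zpow_natCast, cyclicIndex_coe]
  conv_rhs => rw [← Int.emod_add_mul_ediv z n]
  have hβ0 : β ≠ 0 := by
    rintro rfl
    rw [zero_pow (NeZero.ne n)] at hβ
    exact zero_ne_one hβ
  rw [zpow_add₀ hβ0, _root_.zpow_mul, zpow_natCast β n, hβ, _root_.one_zpow, mul_one]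

/-- Evaluation of a rotated word at an `n`-th root of unity. -/
lemma aeval_wordPoly_rotate {β : F} (hβ : β ^ n = 1) (d : ℤ) (x : Fin n → ZMod 2) :
    aeval β (wordPoly (rotate d x)) * β ^ d = aeval β (wordPoly x) := by
  have hβ0 : β ≠ 0 := by
    rintro rfl
    rw [zero_pow (NeZero.ne n)] at hβ
    exact zero_ne_one hβ
  rw [aeval_wordPoly, aeval_wordPoly, Finset.sum_mul, ← Equiv.sum_comp (cyclicIndexEquiv n d)
    fun l => algebraMap (ZMod 2) F (x l) * β ^ (l : ℕ)]
  refine Finset.sum_congr rfl fun l _ => ?_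
  have h : cyclicIndexEquiv n d l = cyclicIndex n ((l : ℕ) + d) := rfl
  rw [h, zpow_cyclicIndex hβ, zpow_add₀ hβ0, zpow_natCast, rotate_apply, mul_assoc]

/-- The words orthogonal to all rotations of `y` vanish where `y` does not vanish at the inverse. -/
lemma aeval_eq_zero_of_dotProduct_rotate {β : F} (hβ : β ^ n = 1) {x y : Fin n → ZMod 2}
    (h : ∀ d, x ⬝ᵥ rotate d y = 0) (hy : aeval β⁻¹ (wordPoly y) ≠ 0) :
    aeval β (wordPoly x) = 0 := by
  have hβ0 : β ≠ 0 := by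
    rintro rfl
    rw [zero_pow (NeZero.ne n)] at hβ
    exact zero_ne_one hβ
  have hβ' : β⁻¹ ^ n = 1 := by rw [inv_pow, hβ, inv_one]
  have h1 : ∑ d : Fin n, algebraMap (ZMod 2) F (x ⬝ᵥ rotate (d : ℕ) y) * β⁻¹ ^ (d : ℕ) = 0 := by
    simp [h]
  -- Convolution theorem: the transform of the cyclic correlation of `x` and `y` is a product.
  have h2 : ∑ d : Fin n, algebraMap (ZMod 2) F (x ⬝ᵥ rotate (d : ℕ) y) * β⁻¹ ^ (d : ℕ)
      = aeval β (wordPoly x) * aeval β⁻¹ (wordPoly y) := by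
    rw [aeval_wordPoly β, Finset.sum_mul]
    simp only [dotProduct, map_sum, map_mul, Finset.sum_mul]
    rw [Finset.sum_comm]
    refine Finset.sum_congr rfl fun l _ => ?_
    rw [← aeval_wordPoly_rotate hβ' (l : ℕ) y, aeval_wordPoly, Finset.sum_mul, Finset.mul_sum]
    refine Finset.sum_congr rfl fun d _ => ?_
    rw [rotate_apply, rotate_apply, add_comm ((l : ℕ) : ℤ), zpow_natCast]
    have h3 : β ^ (l : ℕ) * β⁻¹ ^ (l : ℕ) = 1 := by
      rw [← mul_pow, mul_inv_cancel₀ hβ0, one_pow]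
    linear_combination (-(algebraMap (ZMod 2) F (x l)) *
      algebraMap (ZMod 2) F (y (cyclicIndex n ((d : ℕ) + (l : ℕ)))) * β⁻¹ ^ (d : ℕ)) * h3
  rw [h2] at h1
  exact (mul_eq_zero.1 h1).resolve_right hy

end WordPoly

/-! ### Minimum distance -/

section MinDistance

variable {n : ℕ} {C : Submodule (ZMod 2) (Fin n → ZMod 2)}

lemma minDistance_le {x : Fin n → ZMod 2} (hx : x ∈ C) (h0 : x ≠ 0) :
    minDistance C ≤ hammingNorm x :=
  Nat.sInf_le ⟨x, hx, 0, C.zero_mem, h0, hammingDist_zero_right x⟩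

/-- The nonzero word `x` is essential: for the zero code the infimum is over the empty set and
equals 0. -/
lemma le_minDistance {x : Fin n → ZMod 2} (hx : x ∈ C) (h0 : x ≠ 0) {d : ℕ}
    (h : ∀ y ∈ C, y ≠ 0 → d ≤ hammingNorm y) : d ≤ minDistance C := by
  refine le_csInf ⟨_, x, hx, 0, C.zero_mem, h0, rfl⟩ ?_
  rintro _ ⟨c, hc, c', hc', hne, rfl⟩
  rw [hammingDist_eq_hammingNorm, neg_add_eq_sub]
  exact h _ (sub_mem hc' hc) (sub_ne_zero.2 hne.symm)

lemma two_mul_half_lt_hammingNorm {x : Fin n → ZMod 2} (hx : x ∈ C) (h0 : x ≠ 0)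
    (hC : 0 < minDistance C) : 2 * ((minDistance C - 1) / 2) < hammingNorm x := by
  have := minDistance_le hx h0
  omega

end MinDistance

/-! ### BCH codes -/

section BCH

variable {F : Type*} [Field F] [Algebra (ZMod 2) F] {n : ℕ} {α : F}

lemma isIntegral_pow_of_isPrimitiveRoot (hα : IsPrimitiveRoot α n) (hn : 0 < n) (i : ℕ) :
    IsIntegral (ZMod 2) (α ^ i) :=
  (hα.isIntegral hn).tower_top.pow i

lemma aeval_pow_two_pow (p : (ZMod 2)[X]) (β : F) (s : ℕ) :
    aeval (β ^ 2 ^ s) p = aeval β p ^ 2 ^ s := by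
  induction s with
  | zero => simp
  | succ s ih =>
    rw [pow_succ, pow_mul, pow_mul, ← ih, ← expand_aeval, ZMod.expand_card, map_pow]

lemma minpoly_pow_two_pow {β : F} (hβ : IsIntegral (ZMod 2) β) (s : ℕ) :
    minpoly (ZMod 2) (β ^ 2 ^ s) = minpoly (ZMod 2) β := by
  refine (minpoly.eq_of_irreducible_of_monic (minpoly.irreducible hβ) ?_ (minpoly.monic hβ)).symm
  rw [aeval_pow_two_pow, minpoly.aeval, zero_pow (by positivity)]

/-- The minimal polynomial is an irreducible divisor of X^(2^m) - X, so its degree divides `m`. -/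
lemma natDegree_minpoly_le {β : F} (hβ : IsIntegral (ZMod 2) β) {m : ℕ} (hm : 0 < m)
    (h : β ^ 2 ^ m = β) : (minpoly (ZMod 2) β).natDegree ≤ m := by
  refine Nat.le_of_dvd hm ((minpoly.irreducible hβ).natDegree_dvd_of_dvd_X_pow_card_pow_sub_X ?_)
  refine minpoly.dvd _ _ ?_
  simp [h]

lemma bchGenerator_dvd_of_le {s δ δ' : ℕ} (h : δ ≤ δ') :
    bchGenerator α s δ ∣ bchGenerator α s δ' := by
  classical
  refine Finset.prod_dvd_prod_of_subset _ _ _ (Finset.image_subset_image ?_)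
  exact Finset.Ico_subset_Ico_right (by omega)

lemma minpoly_dvd_bchGenerator {i b : ℕ} (h1 : 1 ≤ i) (h2 : i ≤ b) :
    minpoly (ZMod 2) (α ^ i) ∣ bchGenerator α 1 (b + 1) := by
  classical
  refine Finset.dvd_prod_of_mem (fun p => p) (Finset.mem_image.2 ⟨i, ?_, rfl⟩)
  rw [Finset.mem_Ico]; omega

/-- The minimal polynomials of the odd powers suffice for the generator of a narrow-sense code. -/
lemma bchGenerator_eq_prod [DecidableEq (ZMod 2)[X]] (hα : IsPrimitiveRoot α n) (hn : 0 < n)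
    {b t : ℕ} (hb : b = 2 * t + 1) :
    bchGenerator α 1 (b + 1) =
      ∏ p ∈ (Finset.range (t + 1)).image fun j => minpoly (ZMod 2) (α ^ (2 * j + 1)), p := by
  have h : (Finset.Ico 1 (1 + (b + 1) - 1)).image (fun i : ℕ => minpoly (ZMod 2) (α ^ i))
      = (Finset.range (t + 1)).image fun j => minpoly (ZMod 2) (α ^ (2 * j + 1)) := by
    ext p
    simp only [Finset.mem_image, Finset.mem_Ico, Finset.mem_range]
    constructor
    · rintro ⟨i, ⟨hi1, hi2⟩, rfl⟩
      -- Removing the power of 2 from the exponent only passes to a Frobenius conjugate.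
      obtain ⟨v, q, ⟨j, rfl⟩, rfl⟩ := Nat.exists_eq_two_pow_mul_odd (n := i) (by omega)
      have := Nat.le_mul_of_pos_left (2 * j + 1) (Nat.two_pow_pos v)
      refine ⟨j, by omega, ?_⟩
      rw [mul_comm (2 ^ v), pow_mul,
        minpoly_pow_two_pow (isIntegral_pow_of_isPrimitiveRoot hα hn _)]
    · rintro ⟨j, hj, rfl⟩
      exact ⟨2 * j + 1, by omega, rfl⟩
  rw [bchGenerator, ← h]
  congr!

lemma monic_bchGenerator (hα : IsPrimitiveRoot α n) (hn : 0 < n) (s δ : ℕ) :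
    (bchGenerator α s δ).Monic := by
  classical
  refine monic_prod_of_monic _ _ fun p hp => ?_
  obtain ⟨i, -, rfl⟩ := Finset.mem_image.1 hp
  exact minpoly.monic (isIntegral_pow_of_isPrimitiveRoot hα hn i)

/-- The factors of the generator are distinct monic irreducibles, hence pairwise coprime. -/
lemma bchGenerator_dvd_iff (hα : IsPrimitiveRoot α n) (hn : 0 < n) {b t : ℕ}
    (hb : b = 2 * t + 1) {f : (ZMod 2)[X]} :
    bchGenerator α 1 (b + 1) ∣ f ↔ ∀ j ≤ t, aeval (α ^ (2 * j + 1)) f = 0 := by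
  classical
  constructor
  · intro h j hj
    exact aeval_eq_zero_of_dvd_aeval_eq_zero
      ((minpoly_dvd_bchGenerator (by omega) (by omega)).trans h) (minpoly.aeval _ _)
  · intro h
    rw [bchGenerator_eq_prod hα hn hb]
    have hirr : ∀ p ∈ (Finset.range (t + 1)).image fun j => minpoly (ZMod 2) (α ^ (2 * j + 1)),
        Irreducible p ∧ p.Monic ∧ p ∣ f := by
      intro p hp
      obtain ⟨j, hj, rfl⟩ := Finset.mem_image.1 hp
      have hint := isIntegral_pow_of_isPrimitiveRoot hα hn (2 * j + 1)
      exact ⟨minpoly.irreducible hint, minpoly.monic hint,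
        minpoly.dvd _ _ (h j (by rw [Finset.mem_range] at hj; omega))⟩
    refine Finset.prod_dvd_of_coprime (fun p hp q hq hpq => ?_) fun p hp => (hirr p hp).2.2
    refine (hirr p hp).1.coprime_iff_not_dvd.2 fun hdvd => hpq ?_
    exact eq_of_monic_of_associated (hirr p hp).2.1 (hirr q hq).2.1
      ((hirr p hp).1.associated_of_dvd (hirr q hq).1 hdvd)

/-- The BCH bound. -/
lemma lt_hammingNorm_of_mem_narrowSenseBCH (hα : IsPrimitiveRoot α n) {b : ℕ}
    {x : Fin n → ZMod 2} (hx : x ∈ narrowSenseBCH α n (b + 1)) (h0 : x ≠ 0) :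
    b + 1 ≤ hammingNorm x := by
  classical
  by_contra! hlt
  set S : Finset (Fin n) := Finset.univ.filter fun l => x l ≠ 0 with hS
  have hcard : S.card = hammingNorm x := rfl
  let e : Fin S.card ≃ S := S.equivFin.symm
  have hinj : Function.Injective fun k => α ^ ((e k : Fin n) : ℕ) := fun k k' hk =>
    e.injective (Subtype.ext (Fin.ext (hα.pow_inj (e k).1.2 (e k').1.2 hk)))
  have hroot : ∀ i, 1 ≤ i → i ≤ b → aeval (α ^ i) (wordPoly x) = 0 := fun i h1 h2 =>
    aeval_eq_zero_of_dvd_aeval_eq_zero ((minpoly_dvd_bchGenerator h1 h2).trans hx)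
      (minpoly.aeval _ _)
  -- A Vandermonde system on the support of `x`, with at most `b` unknowns. The factor α^l enters
  -- the unknowns because the zeros start at α¹, not at α⁰.
  have hv := Matrix.eq_zero_of_forall_pow_sum_mul_pow_eq_zero
    (v := fun k => algebraMap (ZMod 2) F (x (e k)) * α ^ ((e k : Fin n) : ℕ)) hinj (fun i => by
      have h1 := hroot (i + 1) (by omega) (by have := i.2; omega)
      rw [aeval_wordPoly] at h1
      rw [Equiv.sum_comp e fun l : S => algebraMap (ZMod 2) F (x l) * α ^ ((l : Fin n) : ℕ) *
        (α ^ ((l : Fin n) : ℕ)) ^ (i : ℕ), Finset.sum_coe_sort S fun l =>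
        algebraMap (ZMod 2) F (x l) * α ^ (l : ℕ) * (α ^ (l : ℕ)) ^ (i : ℕ),
        Finset.sum_filter_of_ne, ← h1]
      · refine Finset.sum_congr rfl fun l _ => ?_
        rw [← pow_mul, ← pow_mul, mul_assoc, ← pow_add]
        congr 2; ring
      · intro l _ hl hxl
        simp [hxl] at hl)
  obtain ⟨l, hl⟩ : ∃ l, x l ≠ 0 := by
    by_contra! hall
    exact h0 (funext hall)
  have hl' : l ∈ S := by simp [hS, hl]
  have h2 := congrFun hv (e.symm ⟨l, hl'⟩)
  have hα0 : α ≠ 0 := hα.ne_zero (by have := l.2; omega)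
  simp [hα0, hl] at h2

end BCH

/-! ### Conjugates and defining sets -/

section Conjugates

variable {F : Type*} [Field F] {n m c h b t : ℕ} {α : F}

lemma IsPrimitiveRoot.pow_eq_pow_iff_natCast_eq (hα : IsPrimitiveRoot α n) (hn : 0 < n) {x y : ℕ} :
    α ^ x = α ^ y ↔ (x : ZMod n) = y := by
  have hα0 : α ≠ 0 := hα.ne_zero hn.ne'
  have h1 : α ^ x = α ^ y ↔ (Units.mk0 α hα0) ^ x = (Units.mk0 α hα0) ^ y := by
    simp [Units.ext_iff]
  rw [h1, pow_eq_pow_iff_modEq, ← orderOf_units, Units.val_mk0, ← hα.eq_orderOf,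
    ZMod.natCast_eq_natCast_iff]

/-- The conjugate `α ^ ((2 j + 1) 2 ^ s)` of an odd power of `α`. -/
def oddConjugate (α : F) (p : ℕ × ℕ) : F := (α ^ (2 * p.1 + 1)) ^ 2 ^ p.2

lemma oddConjugate_pow_eq_one (hα : IsPrimitiveRoot α n) (p : ℕ × ℕ) :
    oddConjugate α p ^ n = 1 := by
  rw [oddConjugate, pow_right_comm _ _ n, pow_right_comm α _ n, hα.pow_eq_one, one_pow, one_pow]

lemma oddConjugate_injOn (H : IsCosetBound n m c h b) (hα : IsPrimitiveRoot α n)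
    (hb : b = 2 * t + 1) :
    Set.InjOn (oddConjugate α) (Finset.range (t + 1) ×ˢ Finset.range m : Finset (ℕ × ℕ)) := by
  rintro ⟨j, s⟩ hp ⟨j', s'⟩ hp' heq
  simp only [Finset.coe_product, Set.mem_prod, Finset.mem_coe, Finset.mem_range] at hp hp'
  simp only [oddConjugate] at heq
  rw [← pow_mul, ← pow_mul, hα.pow_eq_pow_iff_natCast_eq H.length_pos] at heq
  push_cast at heq
  have := H.coset_injective (i := 2 * j + 1) (j := 2 * j' + 1) (by omega) ⟨j, rfl⟩ (by omega)
    ⟨j', rfl⟩ hp.2 hp'.2 (by push_cast; exact heq)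
  exact Prod.ext (by simpa using this.1) this.2

lemma oddConjugate_mul_ne_one (H : IsCosetBound n m c h b) (hα : IsPrimitiveRoot α n)
    (hb : b = 2 * t + 1) {p q : ℕ × ℕ} (hp : p ∈ Finset.range (t + 1) ×ˢ Finset.range m)
    (hq : q ∈ Finset.range (t + 1) ×ˢ Finset.range m) :
    oddConjugate α p * oddConjugate α q ≠ 1 := by
  intro heq
  rw [Finset.mem_product, Finset.mem_range, Finset.mem_range] at hp hq
  rw [oddConjugate, oddConjugate, ← pow_mul, ← pow_mul, ← pow_add, ← pow_zero α,
    hα.pow_eq_pow_iff_natCast_eq H.length_pos] at heq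
  push_cast at heq
  refine H.coset_add_ne_zero (i := 2 * p.1 + 1) (j := 2 * q.1 + 1) (by omega) (by omega) (by omega)
    (by omega) hp.2 hq.2 ?_
  push_cast
  exact heq

/-- The cyclotomic cosets and their negatives fit into the residues modulo `n`. -/
lemma two_mul_card_cosets_le (H : IsCosetBound n m c h b) (hα : IsPrimitiveRoot α n)
    (hb : b = 2 * t + 1) : 2 * m * (t + 1) ≤ n := by
  classical
  set S := (Finset.range (t + 1) ×ˢ Finset.range m).image (oddConjugate α) with hS
  have hcard : S.card = (t + 1) * m := by
    rw [hS, Finset.card_image_of_injOn (oddConjugate_injOn H hα hb)]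
    simp
  have hcard' : (S.image (·⁻¹)).card = (t + 1) * m := by
    rw [Finset.card_image_of_injective _ inv_injective, hcard]
  have hdisj : Disjoint S (S.image (·⁻¹)) := by
    rw [Finset.disjoint_left]
    intro x hx hx'
    obtain ⟨y, hy, rfl⟩ := Finset.mem_image.1 hx'
    obtain ⟨q, hq, rfl⟩ := Finset.mem_image.1 hy
    obtain ⟨p, hp, hpq⟩ := Finset.mem_image.1 hx
    refine oddConjugate_mul_ne_one H hα hb hp hq ?_
    have h0 : oddConjugate α q ≠ 0 := pow_ne_zero _ (pow_ne_zero _ (hα.ne_zero H.length_pos.ne'))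
    rw [hpq, inv_mul_cancel₀ h0]
  have hsub : S ∪ S.image (·⁻¹) ⊆ nthRootsFinset n (1 : F) := by
    intro x hx
    rw [mem_nthRootsFinset H.length_pos]
    rcases Finset.mem_union.1 hx with hx | hx
    · obtain ⟨p, -, rfl⟩ := Finset.mem_image.1 hx
      exact oddConjugate_pow_eq_one hα p
    · obtain ⟨y, hy, rfl⟩ := Finset.mem_image.1 hx
      obtain ⟨p, -, rfl⟩ := Finset.mem_image.1 hy
      simp only [inv_pow, oddConjugate_pow_eq_one hα p, inv_one]
  have := Finset.card_le_card hsub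
  rw [Finset.card_union_of_disjoint hdisj, hcard, hcard', hα.card_nthRootsFinset] at this
  calc 2 * m * (t + 1) = (t + 1) * m + (t + 1) * m := by ring
    _ ≤ n := this

lemma oddConjugate_pow_two_pow (H : IsCosetBound n m c h b) (hα : IsPrimitiveRoot α n) (j : ℕ) :
    (α ^ (2 * j + 1)) ^ 2 ^ m = α ^ (2 * j + 1) := by
  rw [← pow_mul, hα.pow_eq_pow_iff_natCast_eq H.length_pos]
  push_cast
  rw [H.two_pow_eq_one, mul_one]

variable [Algebra (ZMod 2) F]

/-- The roots of the minimal polynomial of an odd power of `α` are its `m` conjugates. -/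
lemma exists_of_aeval_minpoly_eq_zero (H : IsCosetBound n m c h b) (hα : IsPrimitiveRoot α n)
    (hb : b = 2 * t + 1) {j : ℕ} (hj : j ≤ t) {γ : F}
    (hγ : aeval γ (minpoly (ZMod 2) (α ^ (2 * j + 1))) = 0) :
    ∃ s < m, γ = oddConjugate α (j, s) := by
  classical
  have hint := isIntegral_pow_of_isPrimitiveRoot hα H.length_pos (2 * j + 1)
  set p := minpoly (ZMod 2) (α ^ (2 * j + 1)) with hp
  have hp0 : p ≠ 0 := minpoly.ne_zero hint
  set S := (Finset.range m).image fun s => oddConjugate α (j, s) with hS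
  have hcard : S.card = m := by
    rw [hS, Finset.card_image_of_injOn, Finset.card_range]
    intro s hs s' hs' heq
    simp only [Finset.coe_range, Set.mem_Iio] at hs hs'
    have := oddConjugate_injOn H hα hb (by simpa using ⟨by omega, hs⟩)
      (by simpa using ⟨by omega, hs'⟩) heq
    simpa using this
  have hsub : S ⊆ (p.aroots F).toFinset := by
    intro x hx
    obtain ⟨s, -, rfl⟩ := Finset.mem_image.1 hx
    rw [Multiset.mem_toFinset, mem_aroots]
    refine ⟨hp0, ?_⟩
    rw [oddConjugate, aeval_pow_two_pow, hp, minpoly.aeval, zero_pow (by positivity)]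
  -- The degree is at most `m`, so the `m` distinct conjugates exhaust the roots.
  have hle : (p.aroots F).toFinset.card ≤ S.card := by
    rw [hcard]
    refine (Multiset.toFinset_card_le _).trans ((card_roots' _).trans ?_)
    rw [natDegree_map]
    exact natDegree_minpoly_le hint H.pos (oddConjugate_pow_two_pow H hα j)
  have hmem : γ ∈ S := by
    rw [Finset.eq_of_subset_of_card_le hsub hle, Multiset.mem_toFinset, mem_aroots]
    exact ⟨hp0, hγ⟩
  obtain ⟨s, hs, rfl⟩ := Finset.mem_image.1 hmem
  exact ⟨s, Finset.mem_range.1 hs, rfl⟩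

lemma exists_of_aeval_bchGenerator_eq_zero (H : IsCosetBound n m c h b)
    (hα : IsPrimitiveRoot α n) (hb : b = 2 * t + 1) {γ : F}
    (hγ : aeval γ (bchGenerator α 1 (b + 1)) = 0) :
    ∃ p ∈ Finset.range (t + 1) ×ˢ Finset.range m, γ = oddConjugate α p := by
  classical
  rw [bchGenerator_eq_prod hα H.length_pos hb, map_prod, Finset.prod_eq_zero_iff] at hγ
  obtain ⟨q, hq, hγ⟩ := hγ
  obtain ⟨j, hj, rfl⟩ := Finset.mem_image.1 hq
  rw [Finset.mem_range] at hj
  obtain ⟨s, hs, rfl⟩ := exists_of_aeval_minpoly_eq_zero H hα hb (by omega) hγ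
  exact ⟨(j, s), by simp [hj, hs], rfl⟩

lemma natDegree_bchGenerator_le (H : IsCosetBound n m c h b) (hα : IsPrimitiveRoot α n)
    (hb : b = 2 * t + 1) : (bchGenerator α 1 (b + 1)).natDegree ≤ m * (t + 1) := by
  classical
  rw [bchGenerator_eq_prod hα H.length_pos hb]
  refine (natDegree_prod_le _ _).trans ((Finset.sum_le_card_nsmul _ _ m fun q hq => ?_).trans ?_)
  · obtain ⟨j, -, rfl⟩ := Finset.mem_image.1 hq
    exact natDegree_minpoly_le (isIntegral_pow_of_isPrimitiveRoot hα H.length_pos _) H.pos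
      (oddConjugate_pow_two_pow H hα j)
  · rw [smul_eq_mul, mul_comm]
    exact Nat.mul_le_mul_left m (Finset.card_image_le.trans (Finset.card_range _).le)

lemma mem_narrowSenseBCH_iff (H : IsCosetBound n m c h b) (hα : IsPrimitiveRoot α n)
    (hb : b = 2 * t + 1) {x : Fin n → ZMod 2} :
    x ∈ narrowSenseBCH α n (b + 1) ↔ ∀ j ≤ t, aeval (α ^ (2 * j + 1)) (wordPoly x) = 0 :=
  bchGenerator_dvd_iff hα H.length_pos hb

lemma aeval_oddConjugate_eq_zero (H : IsCosetBound n m c h b) (hα : IsPrimitiveRoot α n)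
    (hb : b = 2 * t + 1) {x : Fin n → ZMod 2} (hx : x ∈ narrowSenseBCH α n (b + 1)) {p : ℕ × ℕ}
    (hp : p.1 ≤ t) : aeval (oddConjugate α p) (wordPoly x) = 0 := by
  rw [oddConjugate, aeval_pow_two_pow, (mem_narrowSenseBCH_iff H hα hb).1 hx _ hp,
    zero_pow (by positivity)]

lemma rotate_mem_narrowSenseBCH [NeZero n] (H : IsCosetBound n m c h b)
    (hα : IsPrimitiveRoot α n) (hb : b = 2 * t + 1) (d : ℤ) {x : Fin n → ZMod 2}
    (hx : x ∈ narrowSenseBCH α n (b + 1)) : rotate d x ∈ narrowSenseBCH α n (b + 1) := by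
  rw [mem_narrowSenseBCH_iff H hα hb] at hx ⊢
  intro j hj
  have h1 : (α ^ (2 * j + 1)) ^ n = 1 := by
    simpa [oddConjugate] using oddConjugate_pow_eq_one hα (j, 0)
  have h2 := aeval_wordPoly_rotate h1 d x
  rw [hx j hj] at h2
  exact (mul_eq_zero.1 h2).resolve_right
    (zpow_ne_zero _ (pow_ne_zero _ (hα.ne_zero H.length_pos.ne')))

/-- The word of the generator polynomial. -/
noncomputable def generatorWord (α : F) (n δ : ℕ) : Fin n → ZMod 2 :=
  fun l => (bchGenerator α 1 δ).coeff l

lemma wordPoly_generatorWord (H : IsCosetBound n m c h b) (hα : IsPrimitiveRoot α n)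
    (hb : b = 2 * t + 1) :
    wordPoly (generatorWord α n (b + 1)) = bchGenerator α 1 (b + 1) := by
  refine wordPoly_coeff ((natDegree_bchGenerator_le H hα hb).trans_lt ?_)
  have h1 := two_mul_card_cosets_le H hα hb
  have h2 : 0 < m * (t + 1) := Nat.mul_pos H.pos (Nat.succ_pos t)
  have h3 : 2 * m * (t + 1) = 2 * (m * (t + 1)) := by ring
  omega

lemma generatorWord_mem (H : IsCosetBound n m c h b) (hα : IsPrimitiveRoot α n)
    (hb : b = 2 * t + 1) : generatorWord α n (b + 1) ∈ narrowSenseBCH α n (b + 1) :=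
  (wordPoly_generatorWord H hα hb).symm.dvd

/-- The BCH codes of small design distance contain their duals. -/
lemma dualCode_narrowSenseBCH_le [NeZero n] (H : IsCosetBound n m c h b)
    (hα : IsPrimitiveRoot α n) (hb : b = 2 * t + 1) :
    dualCode (narrowSenseBCH α n (b + 1)) ≤ narrowSenseBCH α n (b + 1) := by
  intro x hx
  rw [mem_narrowSenseBCH_iff H hα hb]
  intro j hj
  have hp : (j, 0) ∈ Finset.range (t + 1) ×ˢ Finset.range m := by
    simp [H.pos]; omega
  have h0 : α ^ (2 * j + 1) = oddConjugate α (j, 0) := by simp [oddConjugate]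
  rw [h0]
  -- A dual word is orthogonal to all rotations of the generator, which does not vanish at the
  -- inverse of any of its zeros.
  refine aeval_eq_zero_of_dotProduct_rotate (oddConjugate_pow_eq_one hα _)
    (fun d => mem_dualCode.1 hx _
      (rotate_mem_narrowSenseBCH H hα hb d (generatorWord_mem H hα hb))) ?_
  rw [wordPoly_generatorWord H hα hb]
  intro hzero
  obtain ⟨q, hq, hpq⟩ := exists_of_aeval_bchGenerator_eq_zero H hα hb hzero
  refine oddConjugate_mul_ne_one H hα hb hp hq ?_
  have h1 : oddConjugate α (j, 0) ≠ 0 :=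
    pow_ne_zero _ (pow_ne_zero _ (hα.ne_zero H.length_pos.ne'))
  rw [← hpq, mul_inv_cancel₀ h1]

lemma le_finrank_narrowSenseBCH_add (H : IsCosetBound n m c h b) (hα : IsPrimitiveRoot α n)
    (hb : b = 2 * t + 1) :
    n ≤ Module.finrank (ZMod 2) (narrowSenseBCH α n (b + 1)) + m * (t + 1) :=
  (le_finrank_cyclicCode_add_natDegree (monic_bchGenerator hα H.length_pos 1 (b + 1)).ne_zero).trans
    (Nat.add_le_add_left (natDegree_bchGenerator_le H hα hb) _)

/-- Rotations of the generator of the larger code are distinct modulo the smaller code, as long as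
they differ by less than the difference of the dimensions. -/
lemma rotate_generatorWord_injective [NeZero n] {a u : ℕ} (H : IsCosetBound n m c h b)
    (Ha : IsCosetBound n m c h a) (hα : IsPrimitiveRoot α n) (hb : b = 2 * t + 1)
    (ha : a = 2 * u + 1) {d d' : ℤ} (hd : |d - d'| < (m * (t - u) : ℕ))
    (hmem : rotate d (generatorWord α n (a + 1)) - rotate d' (generatorWord α n (a + 1))
      ∈ narrowSenseBCH α n (b + 1)) : d = d' := by
  classical
  by_contra hne
  set N := (d - d').natAbs with hN
  have hN0 : 0 < N := Int.natAbs_pos.2 (sub_ne_zero.2 hne)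
  -- The zeros of the generator of the smaller code that are not zeros of the generator of the
  -- larger one; all of them will be `N`-th roots of unity.
  set S := (Finset.Ico (u + 1) (t + 1) ×ˢ Finset.range m).image (oddConjugate α) with hS
  have hcard : S.card = (t - u) * m := by
    rw [hS, Finset.card_image_of_injOn]
    · simp
    · refine (oddConjugate_injOn H hα hb).mono ?_
      rintro ⟨j, s⟩ hp
      simp only [Finset.coe_product, Set.mem_prod, Finset.mem_coe, Finset.mem_Ico,
        Finset.mem_range] at hp ⊢
      exact ⟨hp.1.2, hp.2⟩
  have hsub : S ⊆ nthRootsFinset N (1 : F) := by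
    intro γ hγ
    obtain ⟨p, hp, rfl⟩ := Finset.mem_image.1 hγ
    rw [Finset.mem_product, Finset.mem_Ico, Finset.mem_range] at hp
    rw [mem_nthRootsFinset hN0]
    have hroot := oddConjugate_pow_eq_one hα p
    have h0 : oddConjugate α p ≠ 0 :=
      pow_ne_zero _ (pow_ne_zero _ (hα.ne_zero H.length_pos.ne'))
    have h1 := aeval_oddConjugate_eq_zero H hα hb hmem (p := p) (by omega)
    rw [wordPoly_sub, map_sub, sub_eq_zero] at h1
    have h2 := aeval_wordPoly_rotate hroot d (generatorWord α n (a + 1))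
    have h3 := aeval_wordPoly_rotate hroot d' (generatorWord α n (a + 1))
    rw [wordPoly_generatorWord Ha hα ha] at h2 h3
    have h4 : aeval (oddConjugate α p) (bchGenerator α 1 (a + 1)) ≠ 0 := by
      intro hzero
      obtain ⟨q, hq, hpq⟩ := exists_of_aeval_bchGenerator_eq_zero Ha hα ha hzero
      rw [Finset.mem_product, Finset.mem_range, Finset.mem_range] at hq
      have := oddConjugate_injOn H hα hb (by simp; omega) (by simp; omega) hpq
      rw [this] at hp
      omega
    have h5 : oddConjugate α p ^ d = oddConjugate α p ^ d' := by
      rw [← h3, ← h1] at h2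
      refine mul_left_cancel₀ (fun hz => h4 ?_) h2
      rw [← h3, ← h1, hz, zero_mul]
    have h6 : oddConjugate α p ^ (d - d') = 1 := by
      rw [zpow_sub₀ h0, h5, div_self (zpow_ne_zero _ h0)]
    rcases Int.natAbs_eq (d - d') with h7 | h7
    · rwa [h7, zpow_natCast] at h6
    · rw [h7, _root_.zpow_neg, zpow_natCast] at h6
      exact inv_eq_one.1 h6
  have h1 := Finset.card_le_card hsub
  have h2 : (nthRootsFinset N (1 : F)).card ≤ N := by
    rw [nthRootsFinset_def]
    exact (Multiset.toFinset_card_le _).trans (card_nthRoots N 1)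
  have h3 : (N : ℤ) = |d - d'| := Int.natCast_natAbs _
  have h4 : N < m * (t - u) := by exact_mod_cast h3 ▸ hd
  rw [hcard, mul_comm] at h1
  omega

end Conjugates

theorem theorem5 {F : Type*} [Field F] [Algebra (ZMod 2) F]
    (n m a b t u : ℕ) (hn : 3 ≤ n) (hodd : Nat.Coprime n 2)
    (hm : m = orderOf (2 : ZMod n))
    (hlow : 2 ^ (m / 2) < n) (hupp : n ≤ 2 ^ m - 1)
    (κ : ℚ) (hκ : κ = (n : ℚ) / (2 ^ m - 1) * (2 ^ ⌈(m : ℚ) / 2⌉₊ - 1))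
    (r : ℤ) (hr : r = min (min ⌊(n : ℚ) * 2 ^ ⌈(m : ℚ) / 2⌉₊ / (2 ^ m - 1) - 1⌋ ((n : ℤ) - 1)) ⌊κ⌋)
    (ha : a = 2 * u + 1) (hb : b = 2 * t + 1)
    (hab : a < b) (hbr : (b : ℤ) < r)
    (α : F) (hα : IsPrimitiveRoot α n)
    (C D : Submodule (ZMod 2) (Fin n → ZMod 2))
    (hC : C = narrowSenseBCH α n (b + 1)) (hD : D = narrowSenseBCH α n (a + 1)) :
    C ≤ D ∧ b + 1 ≤ minDistance C ∧ a + 1 ≤ minDistance D ∧ 2 * m * (t + 1) ≤ n ∧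
      ∀ al ar : ℕ, al + ar < m * (t - u) →
        ∃ V : QubitOp (Fin (n + al + ar)) (Fin (n - 2 * m * (t + 1))),
          IsQSC V al ar ((minDistance C - 1) / 2) ((minDistance D - 1) / 2) := by
  subst hC hD
  have hn0 : 0 < n := by omega
  have : NeZero n := ⟨hn0.ne'⟩
  obtain ⟨c, h, H⟩ := IsCosetBound.of_design_lt (b := b) hn hm hupp
    (hbr.trans_le (hr.trans_le ((min_le_left _ _).trans (min_le_left _ _))))
  have Ha : IsCosetBound n m c h a := { H with
    le := (Nat.mul_le_mul_right c (by omega)).trans H.le }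
  have hle : narrowSenseBCH α n (b + 1) ≤ narrowSenseBCH α n (a + 1) := fun x hx =>
    (bchGenerator_dvd_of_le (by omega)).trans hx
  have hcount := two_mul_card_cosets_le H hα hb
  have hdim := le_finrank_narrowSenseBCH_add H hα hb
  have h2 : 2 * m * (t + 1) = 2 * (m * (t + 1)) := by ring
  -- The dimension of the code is at least n - m(t+1) ≥ n/2 > 0.
  obtain ⟨x, hx, hx0⟩ : ∃ x ∈ narrowSenseBCH α n (b + 1), x ≠ 0 := by
    refine Submodule.exists_mem_ne_zero_of_ne_bot fun hbot => ?_
    rw [hbot, finrank_bot] at hdim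
    omega
  have hdC : b + 1 ≤ minDistance (narrowSenseBCH α n (b + 1)) :=
    le_minDistance hx hx0 fun y hy hy0 => lt_hammingNorm_of_mem_narrowSenseBCH hα hy hy0
  have hdD : a + 1 ≤ minDistance (narrowSenseBCH α n (a + 1)) :=
    le_minDistance (hle hx) hx0 fun y hy hy0 => lt_hammingNorm_of_mem_narrowSenseBCH hα hy hy0
  refine ⟨hle, hdC, hdD, hcount, fun al ar hlr => ?_⟩
  refine exists_isQSC_of_nested_cyclic (dualCode_narrowSenseBCH_le H hα hb) hle
    (fun d x hx => rotate_mem_narrowSenseBCH H hα hb d hx)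
    (fun d x hx => rotate_mem_narrowSenseBCH Ha hα ha d hx)
    (generatorWord_mem Ha hα ha) (fun d d' h1 h2 h3 h4 hmem => ?_) (by omega)
    (fun x hx hx0 => two_mul_half_lt_hammingNorm hx hx0 (by omega))
    (fun x hx hx0 => two_mul_half_lt_hammingNorm hx hx0 (by omega))
  -- Two misalignments in [-al, ar] differ by at most al + ar < m(t-u).
  refine rotate_generatorWord_injective H Ha hα hb ha ?_ hmem
  refine lt_of_le_of_lt ?_ (Int.ofNat_lt.2 hlr)
  rw [abs_le]
  push_cast
  constructor <;> omega
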